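/- Let $d,k\ge 1$ and $\lambda,\mu\ge 0$. Let $B$ and $R$ be the Hilbert spaces with orthonormal bases $|\vec n\rangle$, where $\vec n=(n_1,\dots,n_d)$ runs over the vectors of nonnegative integers with $\sum_i n_i=k$ for $B$ and $\sum_i n_i=k-1$ for $R$ (so $B$ is the completely symmetric subspace of $k$ qudits). The $1\to k$ universal qudit cloner is the isometry $$V:\mathbb C^d\to B\otimes R,\qquad V|i\rangle=\sum_{\vec j:\ \sum_l j_l=k-1}\sqrt{\frac{(k-1)!\,d!}{(k+d-1)!}}\,\sqrt{1+j_i}\;|\vec e_i+\vec j\rangle_B\otimes|\vec j\rangle_R ,$$ where $\vec e_i$ is the $i$-th standard unit vector, and the $1\to k$ universal qudit cloning channel is $Cl(\rho)=\mathrm{Tr}_R(V\rho V^\dagger)$. Let $U:\mathbb C^d\to B\otimes E$, with $E$ finite-dimensional, be an isometric extension of $Cl$, that is, $U^\dagger U=I$ and $\mathrm{Tr}_E(U\rho U^\dagger)=Cl(\rho)$ for all $\rho$. For a finite ensemble $\{p(x,y),\psi_{x,y}\}$ of pure states of $A'=\mathbb C^d$, indexed by two classical registers $X,Y$, let $$\omega^{XYBE}=\sum_{x,y}p(x,y)\,|x\rangle\langle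 x|^X\otimes|y\rangle\langle y|^Y\otimes U\,|\psi_{x,y}\rangle\langle\psi_{x,y}|\,U^\dagger .$$ The private dynamic capacity formula $P_{\lambda,\mu}(Cl)$ is the maximum over all such ensembles of $$I(YX;B)_\omega+\lambda\,[H(B|X)_\omega-H(E|X)_\omega]+\mu\,[H(B)_\omega-H(E|X)_\omega],$$ where $H$ and $I$ are the von Neumann entropy and the quantum mutual information. Then the maximum exists, and it is attained by an ensemble of the form $$\frac1d\left(|1\rangle\langle1|^X\otimes\psi_1^{YA'}+\cdots+|d\rangle\langle d|^X\otimes\psi_d^{YA'}\right),\qquad \psi_x^{YA'}=\sum_{y=1}^d\nu_{(y-x)\bmod d}\;|y\rangle\langle y|^Y\otimes|y\rangle\langle y|^{A'},$$ for some $\nu_0,\dots,\nu_{d-1}\ge0$ with $\nu_0=1-\nu_1-\cdots-\nu_{d-1}$. -/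

import Mathlib

open scoped Matrix Kronecker Nat

/-! ### Entropy and partial traces of finite-dimensional states -/

/-- The von Neumann entropy `-Tr (ρ log ρ)` of a Hermitian matrix, computed from its eigenvalues
(natural logarithm, `0 log 0 = 0`). The value at a matrix that is not Hermitian is irrelevant. -/
noncomputable def vonNeumannEntropy {n : Type*} [Fintype n] [DecidableEq n]
    (ρ : Matrix n n ℂ) : ℝ :=
  open scoped Classical in
  if h : ρ.IsHermitian then ∑ i, Real.negMulLog (h.eigenvalues i) else 0

/-- The partial trace over the second tensor factor. -/
def traceSecond {B E : Type*} [Fintype E] (M : Matrix (B × E) (B × E) ℂ) : Matrix B B ℂ :=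
  Matrix.of fun b b' => ∑ e, M (b, e) (b', e)

section Marginals

variable {X Y B E : Type*} [Fintype X] [Fintype Y] [Fintype B] [Fintype E]

/-- The reduced operator on `X` of an operator on `XYBE`. -/
def marginalX (ω : Matrix (X × Y × B × E) (X × Y × B × E) ℂ) : Matrix X X ℂ :=
  Matrix.of fun x x' => ∑ y, ∑ b, ∑ e, ω (x, y, b, e) (x', y, b, e)

/-- The reduced operator on `XY` of an operator on `XYBE`. -/
def marginalXY (ω : Matrix (X × Y × B × E) (X × Y × B × E) ℂ) : Matrix (X × Y) (X × Y) ℂ :=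
  Matrix.of fun s t => ∑ b, ∑ e, ω (s.1, s.2, b, e) (t.1, t.2, b, e)

/-- The reduced operator on `B` of an operator on `XYBE`. -/
def marginalB (ω : Matrix (X × Y × B × E) (X × Y × B × E) ℂ) : Matrix B B ℂ :=
  Matrix.of fun b b' => ∑ x, ∑ y, ∑ e, ω (x, y, b, e) (x, y, b', e)

/-- The reduced operator on `XB` of an operator on `XYBE`. -/
def marginalXB (ω : Matrix (X × Y × B × E) (X × Y × B × E) ℂ) : Matrix (X × B) (X × B) ℂ :=
  Matrix.of fun s t => ∑ y, ∑ e, ω (s.1, y, s.2, e) (t.1, y, t.2, e)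

/-- The reduced operator on `XE` of an operator on `XYBE`. -/
def marginalXE (ω : Matrix (X × Y × B × E) (X × Y × B × E) ℂ) : Matrix (X × E) (X × E) ℂ :=
  Matrix.of fun s t => ∑ y, ∑ b, ω (s.1, y, b, s.2) (t.1, y, b, t.2)

/-- The reduced operator on `XYB` of an operator on `XYBE`. -/
def marginalXYB (ω : Matrix (X × Y × B × E) (X × Y × B × E) ℂ) :
    Matrix (X × Y × B) (X × Y × B) ℂ :=
  Matrix.of fun s t => ∑ e, ω (s.1, s.2.1, s.2.2, e) (t.1, t.2.1, t.2.2, e)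

variable [DecidableEq X] [DecidableEq Y] [DecidableEq B] [DecidableEq E]

/-- The entropy `H(B)_ω`. -/
noncomputable def entropyB (ω : Matrix (X × Y × B × E) (X × Y × B × E) ℂ) : ℝ :=
  vonNeumannEntropy (marginalB ω)

/-- The conditional entropy `H(B|X)_ω = H(XB)_ω - H(X)_ω`. -/
noncomputable def condEntropyBX (ω : Matrix (X × Y × B × E) (X × Y × B × E) ℂ) : ℝ :=
  vonNeumannEntropy (marginalXB ω) - vonNeumannEntropy (marginalX ω)

/-- The conditional entropy `H(E|X)_ω = H(XE)_ω - H(X)_ω`. -/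
noncomputable def condEntropyEX (ω : Matrix (X × Y × B × E) (X × Y × B × E) ℂ) : ℝ :=
  vonNeumannEntropy (marginalXE ω) - vonNeumannEntropy (marginalX ω)

/-- The mutual information `I(YX;B)_ω = H(YX)_ω + H(B)_ω - H(YXB)_ω`. -/
noncomputable def mutualInfoYXB (ω : Matrix (X × Y × B × E) (X × Y × B × E) ℂ) : ℝ :=
  vonNeumannEntropy (marginalXY ω) + vonNeumannEntropy (marginalB ω)
    - vonNeumannEntropy (marginalXYB ω)

end Marginals

/-! ### The private dynamic capacity formula -/

/-- An ensemble `{p(x, y), ψ_{x,y}}` of pure states of a `d`-dimensional system, indexed by two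
classical registers with finite alphabets `X` and `Y`. -/
structure PureEnsemble (X Y : Type*) [Fintype X] [Fintype Y] (d : ℕ) where
  prob : X → Y → ℝ
  prob_nonneg : ∀ x y, 0 ≤ prob x y
  prob_sum : ∑ x, ∑ y, prob x y = 1
  state : X → Y → Fin d → ℂ
  state_unit : ∀ x y, ∑ i, ‖state x y i‖ ^ 2 = 1

/-- `U : ℂ^d → B ⊗ E` is an isometric extension of the map `N` on `d × d` matrices:
`U` is an isometry and `N(ρ) = Tr_E (U ρ U†)`. -/
def IsIsometricExtension {d : ℕ} {B E : Type*} [Fintype B] [Fintype E]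
    (N : Matrix (Fin d) (Fin d) ℂ → Matrix B B ℂ) (U : Matrix (B × E) (Fin d) ℂ) : Prop :=
  Uᴴ * U = 1 ∧ ∀ ρ : Matrix (Fin d) (Fin d) ℂ, traceSecond (U * ρ * Uᴴ) = N ρ

section Formula

variable {d : ℕ} {B E : Type*} [Fintype B] [Fintype E] [DecidableEq B] [DecidableEq E]

/-- The state `ω = ∑_{x,y} p(x,y) |x⟩⟨x| ⊗ |y⟩⟨y| ⊗ U |ψ_{x,y}⟩⟨ψ_{x,y}| U†` on `XYBE`. -/
noncomputable def outputState {X Y : Type*} [Fintype X] [Fintype Y] [DecidableEq X] [DecidableEq Y]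
    (U : Matrix (B × E) (Fin d) ℂ) (ens : PureEnsemble X Y d) :
    Matrix (X × Y × B × E) (X × Y × B × E) ℂ :=
  ∑ x, ∑ y, (ens.prob x y : ℂ) •
    ((Matrix.single x x (1 : ℂ)) ⊗ₖ ((Matrix.single y y (1 : ℂ)) ⊗ₖ
      (U * Matrix.vecMulVec (ens.state x y) (star (ens.state x y)) * Uᴴ)))

/-- The quantity `I(YX;B) + λ [H(B|X) - H(E|X)] + μ [H(B) - H(E|X)]` for an ensemble that is sent
through the isometry `U`. -/
noncomputable def privateDynamicObjective {X Y : Type*} [Fintype X] [Fintype Y]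
    [DecidableEq X] [DecidableEq Y]
    (U : Matrix (B × E) (Fin d) ℂ) (lam mu : ℝ) (ens : PureEnsemble X Y d) : ℝ :=
  mutualInfoYXB (outputState U ens)
    + lam * (condEntropyBX (outputState U ens) - condEntropyEX (outputState U ens))
    + mu * (entropyB (outputState U ens) - condEntropyEX (outputState U ens))

/-- All values of the objective, over all finite alphabets and all ensembles of pure states.
The private dynamic capacity formula `P_{λ,μ}` is the maximum of this set. -/
def privateDynamicValues (U : Matrix (B × E) (Fin d) ℂ) (lam mu : ℝ) : Set ℝ :=
  {r | ∃ (X Y : Type) (_ : Fintype X) (_ : Fintype Y) (_ : DecidableEq X) (_ : DecidableEq Y)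
    (ens : PureEnsemble X Y d), r = privateDynamicObjective U lam mu ens}

end Formula

/-! ### The universal qudit cloner -/

/-- Occupation vectors `(n_1, …, n_d)` of natural numbers with `∑ n_i = n`; they index the
orthonormal basis `|n_1, …, n_d⟩` of the completely symmetric subspace of `n` qudits. -/
abbrev Occupation (d n : ℕ) : Type :=
  {m : Fin d → ℕ // m ∈ Finset.piAntidiag (Finset.univ : Finset (Fin d)) n}

/-- The coefficient `α_{n,j}` of the `N → M` universal cloner in dimension `d`. -/
noncomputable def cloningCoeff (d N M : ℕ) (n j : Fin d → ℕ) : ℝ :=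
  √(((M - N)! * (N + d - 1)! : ℝ) / ((M + d - 1)! : ℝ)) *
    √(∏ i, (((n i + j i)! : ℝ) / ((n i)! * (j i)! : ℝ)))

/-- The `1 → k` universal cloner `|i⟩ ↦ ∑_j α_{e_i,j} |e_i + j⟩ ⊗ R_j`, where `j` runs over the
occupation vectors of total `k - 1` and the `R_j` are orthonormal states of the auxiliary system. -/
noncomputable def cloningIsometry (d k : ℕ) :
    Matrix (Occupation d k × Occupation d (k - 1)) (Fin d) ℂ :=
  Matrix.of fun s i =>
    if s.1.1 = Pi.single i 1 + s.2.1 then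
      (cloningCoeff d 1 k (Pi.single i 1) s.2.1 : ℂ) else 0

/-- The `1 → k` universal qudit cloning channel: the auxiliary output of the cloner is
traced out. -/
noncomputable def cloningChannel (d k : ℕ) (ρ : Matrix (Fin d) (Fin d) ℂ) :
    Matrix (Occupation d k) (Occupation d k) ℂ :=
  traceSecond (cloningIsometry d k * ρ * (cloningIsometry d k)ᴴ)

/-! ### Ensembles of cyclic shifts -/

/-- The ensemble `(1/d) ∑_x |x⟩⟨x| ⊗ ψ_x` with
`ψ_x = ∑_y ν_{y - x} |y⟩⟨y| ⊗ |y⟩⟨y|`, indices modulo `d`, for a probability vector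
`ν = (ν_0, …, ν_{d-1})`, so that `ν_0 = 1 - ν_1 - ⋯ - ν_{d-1}`. -/
noncomputable def cyclicEnsemble (d : ℕ) [NeZero d] (ν : Fin d → ℝ)
    (hν : ν ∈ stdSimplex ℝ (Fin d)) : PureEnsemble (Fin d) (Fin d) d where
  prob x y := (1 / (d : ℝ)) * ν (y - x)
  prob_nonneg x y := mul_nonneg (by positivity) (hν.1 _)
  prob_sum := by
    have h : ∀ x : Fin d, ∑ y : Fin d, (1 / (d : ℝ)) * ν (y - x) = 1 / (d : ℝ) := by
      intro x
      have h1 : ∑ y : Fin d, ν (y - x) = ∑ y, ν y := (Equiv.subRight x).sum_comp ν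
      rw [← Finset.mul_sum, h1, hν.2, mul_one]
    have hd : (d : ℝ) ≠ 0 := Nat.cast_ne_zero.2 (NeZero.ne d)
    simp only [h, Finset.sum_const, Finset.card_univ, Fintype.card_fin, nsmul_eq_mul]
    field_simp
  state _ y := Pi.single y 1
  state_unit _ y := by
    rw [Finset.sum_eq_single y] <;> simp +contextual

/-! ### Entropy through characteristic polynomials, block sums and Jensen -/

section Entropy

open Matrix
open scoped ComplexOrder

variable {n m : Type*} [Fintype n] [DecidableEq n] [Fintype m] [DecidableEq m]

/-! Let `ρ_x` be the conditional input given `x` and `ρ` the average input. Since entropies of block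
sums split, the objective equals `(1 + μ) H(Cl ρ) - ∑ p(x,y) H(Cl ψ_{x,y}) + ∑ p(x) G(ρ_x)`, where
`G = λ (H(B) - H(E)) - μ H(E)` is `conditionalGain` (`privateDynamicObjective_eq`).

Each term is controlled by unitary covariance of the channel (`cloningChannel_covariant`). Up to a
scalar, `Cl ρ` is the compression `S† (ρ ⊗ 1) S` of `ρ ⊗ 1` to the symmetric subspace, and tensor
powers of a unitary preserve that subspace. The entropy of `E` is determined by the channel alone
(`vonNeumannEntropy_traceFirst_eq`), so it inherits the invariance, whatever the extension `U`.

Hence all pure inputs have the same output entropy, and `G` depends only on the spectrum of `ρ_x`.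
The first term is at most `(1 + μ) log dim B`, with equality at the maximally mixed input; the last
is at most the maximum of `G` over diagonal states, which exists by compactness of the simplex.
Cyclic shifts of a maximizing spectrum `ν` reach both bounds at once: every `ρ_x` is a permutation
of `ν`, and their uniform average is maximally mixed. -/

theorem vonNeumannEntropy_eq_roots {M : Matrix n n ℂ} (h : M.IsHermitian) :
    vonNeumannEntropy M = (M.charpoly.roots.map fun z => Real.negMulLog z.re).sum := by
  rw [vonNeumannEntropy, dif_pos h, h.roots_charpoly_eq_eigenvalues, Multiset.map_map]
  rfl

theorem vonNeumannEntropy_congr_charpoly {M N : Matrix n n ℂ} (hM : M.IsHermitian)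
    (hN : N.IsHermitian) (h : M.charpoly = N.charpoly) :
    vonNeumannEntropy M = vonNeumannEntropy N := by
  rw [vonNeumannEntropy_eq_roots hM, vonNeumannEntropy_eq_roots hN, h]

theorem vonNeumannEntropy_diagonal (v : n → ℝ) :
    vonNeumannEntropy (diagonal fun i => (v i : ℂ)) = ∑ i, Real.negMulLog (v i) := by
  have h : (diagonal fun i => (v i : ℂ)).IsHermitian := by
    rw [isHermitian_diagonal_iff]
    intro i
    simp [isSelfAdjoint_iff]
  rw [vonNeumannEntropy_eq_roots h, charpoly_diagonal, Polynomial.roots_prod]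
  · simp
  · simp [Finset.prod_ne_zero_iff, Polynomial.X_sub_C_ne_zero]

theorem vonNeumannEntropy_conj {M : Matrix n n ℂ} (hM : M.IsHermitian) {W : Matrix n n ℂ}
    (hW : Wᴴ * W = 1) : vonNeumannEntropy (W * M * Wᴴ) = vonNeumannEntropy M := by
  refine vonNeumannEntropy_congr_charpoly (isHermitian_mul_mul_conjTranspose W hM) hM ?_
  rw [charpoly_mul_comm, ← mul_assoc, hW, one_mul]

theorem vonNeumannEntropy_reindex {M : Matrix n n ℂ} (hM : M.IsHermitian) (e : n ≃ m) :
    vonNeumannEntropy (reindex e e M) = vonNeumannEntropy M := by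
  have h : (reindex e e M).IsHermitian := hM.submatrix _
  rw [vonNeumannEntropy_eq_roots hM, vonNeumannEntropy_eq_roots h, charpoly_reindex]

/-- The two characteristic polynomials differ only by powers of `X`, and zero roots contribute
nothing because `negMulLog 0 = 0`. This is what transfers the entropy of `E` to data on the `B`
side. -/
theorem vonNeumannEntropy_mul_conjTranspose_comm (K : Matrix m n ℂ) :
    vonNeumannEntropy (K * Kᴴ) = vonNeumannEntropy (Kᴴ * K) := by
  rw [vonNeumannEntropy_eq_roots (isHermitian_mul_conjTranspose_self K),
    vonNeumannEntropy_eq_roots (isHermitian_conjTranspose_mul_self K)]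
  have h := congrArg (fun p => (p.roots.map fun z => Real.negMulLog z.re).sum)
    (charpoly_mul_comm' K Kᴴ)
  simpa [Polynomial.roots_mul (mul_ne_zero (pow_ne_zero _ Polynomial.X_ne_zero)
    (charpoly_monic _).ne_zero), Multiset.map_nsmul, Multiset.sum_nsmul] using h

theorem Matrix.IsHermitian.exists_conj_diagonal {M : Matrix n n ℂ} (hM : M.IsHermitian) :
    ∃ (W : Matrix n n ℂ) (v : n → ℝ), Wᴴ * W = 1 ∧ W * Wᴴ = 1 ∧
      M = W * diagonal (fun i => (v i : ℂ)) * Wᴴ ∧ (∀ i, v i = hM.eigenvalues i) := by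
  refine ⟨hM.eigenvectorUnitary, hM.eigenvalues, ?_, ?_, ?_, fun _ => rfl⟩
  · exact Unitary.coe_star_mul_self hM.eigenvectorUnitary
  · exact Unitary.coe_mul_star_self hM.eigenvectorUnitary
  · have := hM.spectral_theorem
    rwa [Unitary.conjStarAlgAut_apply] at this

theorem vonNeumannEntropy_conj_diagonal {W : Matrix n n ℂ} (hW : Wᴴ * W = 1) (v : n → ℝ) :
    vonNeumannEntropy (W * diagonal (fun i => (v i : ℂ)) * Wᴴ) = ∑ i, Real.negMulLog (v i) := by
  rw [vonNeumannEntropy_conj _ hW, vonNeumannEntropy_diagonal]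
  rw [isHermitian_diagonal_iff]
  intro i
  simp [isSelfAdjoint_iff]

theorem vonNeumannEntropy_smul {M : Matrix n n ℂ} (hM : M.IsHermitian) (p : ℝ) :
    vonNeumannEntropy ((p : ℂ) • M) =
      p * vonNeumannEntropy M + M.trace.re * Real.negMulLog p := by
  obtain ⟨W, v, hW, -, rfl, -⟩ := hM.exists_conj_diagonal
  have h : (p : ℂ) • (W * diagonal (fun i => (v i : ℂ)) * Wᴴ)
      = W * diagonal (fun i => ((p * v i : ℝ) : ℂ)) * Wᴴ := by
    rw [← smul_mul_assoc, ← mul_smul_comm]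
    congr 2
    ext i j
    by_cases hij : i = j <;> simp [hij]
  rw [h, vonNeumannEntropy_conj_diagonal hW, vonNeumannEntropy_conj_diagonal hW, trace_mul_comm,
    ← mul_assoc, hW, one_mul, trace_diagonal, ← Complex.ofReal_sum, Complex.ofReal_re,
    Finset.mul_sum, Finset.sum_mul, ← Finset.sum_add_distrib]
  refine Finset.sum_congr rfl fun i _ => ?_
  rw [Real.negMulLog_mul]
  ring

theorem vonNeumannEntropy_blockDiagonal {σ : m → Matrix n n ℂ} (hσ : ∀ x, (σ x).IsHermitian) :
    vonNeumannEntropy (blockDiagonal σ) = ∑ x, vonNeumannEntropy (σ x) := by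
  choose W v hW _ hM _ using fun x => (hσ x).exists_conj_diagonal
  have h : blockDiagonal σ = blockDiagonal W *
      diagonal (fun s : n × m => ((v s.2 s.1 : ℝ) : ℂ)) * (blockDiagonal W)ᴴ := by
    rw [← blockDiagonal_diagonal (fun x i => ((v x i : ℝ) : ℂ)), blockDiagonal_conjTranspose,
      ← blockDiagonal_mul, ← blockDiagonal_mul]
    congr 1
    exact funext hM
  have hW' : (blockDiagonal W)ᴴ * blockDiagonal W = 1 := by
    rw [blockDiagonal_conjTranspose, ← blockDiagonal_mul, ← blockDiagonal_one]
    congr 1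
    exact funext hW
  rw [h, vonNeumannEntropy_conj_diagonal hW', Fintype.sum_prod_type_right]
  refine Finset.sum_congr rfl fun x _ => ?_
  rw [hM x, vonNeumannEntropy_conj_diagonal (hW x)]

/-- The direct sum of a family of blocks, with the block index as first tensor factor. -/
def directSum (σ : m → Matrix n n ℂ) : Matrix (m × n) (m × n) ℂ :=
  Matrix.of fun s t => if s.1 = t.1 then σ s.1 s.2 t.2 else 0

theorem vonNeumannEntropy_directSum {σ : m → Matrix n n ℂ} (hσ : ∀ x, (σ x).IsHermitian) :
    vonNeumannEntropy (directSum σ) = ∑ x, vonNeumannEntropy (σ x) := by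
  have h : directSum σ = reindex (Equiv.prodComm n m) (Equiv.prodComm n m) (blockDiagonal σ) := by
    ext s t
    simp [directSum, blockDiagonal_apply]
  rw [h, vonNeumannEntropy_reindex, vonNeumannEntropy_blockDiagonal hσ]
  rw [IsHermitian, blockDiagonal_conjTranspose]
  exact congrArg _ (funext hσ)

/-- Jensen for the concave `negMulLog` with uniform weights. -/
theorem sum_negMulLog_le_log_card {ι : Type*} [Fintype ι] [Nonempty ι] {v : ι → ℝ} (hv : ∀ i, 0 ≤ v i)
    (hs : ∑ i, v i = 1) : ∑ i, Real.negMulLog (v i) ≤ Real.log (Fintype.card ι) := by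
  have hc : (0 : ℝ) < Fintype.card ι := by exact_mod_cast Fintype.card_pos
  have := Real.concaveOn_negMulLog.le_map_sum (t := Finset.univ)
    (w := fun _ : ι => (Fintype.card ι : ℝ)⁻¹) (p := v) (fun _ _ => by positivity)
    (by simp) (fun i _ => hv i)
  simp only [smul_eq_mul, ← Finset.mul_sum, hs, mul_one] at this
  rw [Real.negMulLog, Real.log_inv, neg_mul_neg] at this
  exact le_of_mul_le_mul_left this (inv_pos.2 hc)

theorem vonNeumannEntropy_le_log_card [Nonempty n] {M : Matrix n n ℂ} (hM : M.PosSemidef)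
    (ht : M.trace = 1) : vonNeumannEntropy M ≤ Real.log (Fintype.card n) := by
  rw [vonNeumannEntropy, dif_pos hM.isHermitian]
  refine sum_negMulLog_le_log_card hM.eigenvalues_nonneg ?_
  have := congrArg Complex.re hM.isHermitian.trace_eq_sum_eigenvalues
  simpa [ht] using this.symm

theorem vonNeumannEntropy_uniform [Nonempty n] {M : Matrix n n ℂ} {c : ℂ} (hM : M = c • 1)
    (ht : M.trace = 1) : vonNeumannEntropy M = Real.log (Fintype.card n) := by
  have hc : (Fintype.card n : ℝ) ≠ 0 := by exact_mod_cast Fintype.card_ne_zero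
  have h : c = ((Fintype.card n : ℝ)⁻¹ : ℝ) := by
    rw [hM, trace_smul, trace_one, smul_eq_mul] at ht
    rw [eq_comm, Complex.ofReal_inv, inv_eq_iff_eq_inv]
    simpa using eq_inv_of_mul_eq_one_right ht
  have hM' : M = diagonal fun _ : n => (((Fintype.card n : ℝ)⁻¹ : ℝ) : ℂ) := by
    rw [hM, h, smul_one_eq_diagonal]
  rw [hM', vonNeumannEntropy_diagonal]
  simp only [Finset.sum_const, Finset.card_univ, nsmul_eq_mul, Real.negMulLog, Real.log_inv]
  field_simp

end Entropy

/-! ### The symmetric subspace inside the tensor power -/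

section Cloner

open Matrix

variable {d : ℕ}

/-- The occupation vector of a sequence of basis labels. -/
def occ {k : ℕ} (f : Fin k → Fin d) : Fin d → ℕ := fun i => Fintype.card {a // f a = i}

theorem occ_cons {r : ℕ} (i : Fin d) (t : Fin r → Fin d) :
    occ (Fin.cons i t : Fin (r + 1) → Fin d) = Pi.single i 1 + occ t := by
  funext l
  simp only [occ, Fintype.card_subtype, Finset.card_filter, Fin.sum_univ_succ, Fin.cons_zero,
    Fin.cons_succ, Pi.add_apply, Pi.single_apply, eq_comm]

theorem sum_occ {k : ℕ} (f : Fin k → Fin d) : ∑ i, occ f i = k := by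
  simp only [occ, ← Fintype.card_sigma]
  rw [Fintype.card_congr (Equiv.sigmaFiberEquiv f), Fintype.card_fin]

theorem occ_comp_perm {k : ℕ} (f : Fin k → Fin d) (σ : Equiv.Perm (Fin k)) :
    occ (f ∘ σ) = occ f := by
  funext i
  exact Fintype.card_congr (σ.subtypeEquiv fun a => Iff.rfl)

theorem exists_perm_of_occ_eq {k : ℕ} {f g : Fin k → Fin d} (h : occ f = occ g) :
    ∃ σ : Equiv.Perm (Fin k), f = g ∘ σ := by
  have e : ∀ i, {a // f a = i} ≃ {a // g a = i} := fun i =>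
    Fintype.equivOfCardEq (congrFun h i)
  refine ⟨(Equiv.sigmaFiberEquiv f).symm.trans
    ((Equiv.sigmaCongrRight e).trans (Equiv.sigmaFiberEquiv g)), funext fun a => ?_⟩
  exact ((e (f a)) ⟨a, rfl⟩).2.symm

/-- The number of sequences with a given occupation vector. -/
def occCount (k : ℕ) (m : Fin d → ℕ) : ℕ :=
  (Finset.univ.filter fun f : Fin k → Fin d => occ f = m).card

theorem prod_factorial_single_add (i : Fin d) (j : Fin d → ℕ) :
    ∏ l, ((Pi.single i 1 + j : Fin d → ℕ) l)! = (j i + 1) * ∏ l, (j l)! := by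
  rw [← Finset.mul_prod_erase _ _ (Finset.mem_univ i),
    ← Finset.mul_prod_erase _ (fun l => (j l)!) (Finset.mem_univ i), ← mul_assoc,
    ← Nat.factorial_succ]
  congr 1
  · simp [add_comm]
  · refine Finset.prod_congr rfl fun l hl => ?_
    simp [Finset.ne_of_mem_erase hl]

theorem occCount_succ (k : ℕ) (m : Fin d → ℕ) :
    occCount (k + 1) m = ∑ i, if 1 ≤ m i then occCount k (m - Pi.single i 1) else 0 := by
  have h : occCount (k + 1) m = ∑ i, (Finset.univ.filter
      fun t : Fin k → Fin d => Pi.single i 1 + occ t = m).card := by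
    simp only [occCount, Finset.card_filter]
    rw [← (Fin.consEquiv fun _ => Fin d).sum_comp, Fintype.sum_prod_type]
    exact Finset.sum_congr rfl fun i _ => Finset.sum_congr rfl fun t _ => by
      rw [← occ_cons]; rfl
  rw [h]
  refine Finset.sum_congr rfl fun i _ => ?_
  split_ifs with hi
  · rw [occCount]
    congr 1
    ext t
    simp only [Finset.mem_filter, Finset.mem_univ, true_and]
    have hle : Pi.single i 1 ≤ m := by
      intro l
      by_cases hl : l = i
      · subst hl; simpa using hi
      · simp [hl]
    rw [eq_tsub_iff_add_eq_of_le hle, add_comm]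
  · rw [Finset.card_eq_zero, Finset.filter_eq_empty_iff]
    rintro t - rfl
    simp at hi

/-- `occCount` is the multinomial coefficient; the induction removes the first letter of a sequence.
-/
theorem occCount_mul_prod_factorial (k : ℕ) (m : Fin d → ℕ) (hm : ∑ i, m i = k) :
    occCount k m * ∏ i, (m i)! = k ! := by
  induction k generalizing m with
  | zero =>
    have : m = 0 := by
      funext i
      exact (Finset.sum_eq_zero_iff.1 hm) i (Finset.mem_univ i)
    subst this
    simp [occCount, occ, funext_iff]
  | succ k ih =>
    rw [occCount_succ, Finset.sum_mul, Nat.factorial_succ, ← hm, Finset.sum_mul]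
    refine Finset.sum_congr rfl fun i _ => ?_
    split_ifs with hi
    · have hle : Pi.single i 1 ≤ m := by
        intro l
        by_cases hl : l = i
        · subst hl; simpa using hi
        · simp [hl]
      obtain ⟨j, rfl⟩ := exists_add_of_le hle
      rw [add_tsub_cancel_left, prod_factorial_single_add]
      have hj : ∑ l, j l = k := by
        simp [Finset.sum_add_distrib] at hm
        omega
      rw [← ih j hj]
      simp only [Pi.add_apply, Pi.single_eq_same]
      ring
    · have : m i = 0 := by omega
      simp [this]

theorem occCount_pos {k : ℕ} (m : Occupation d k) : 0 < occCount k m.1 := by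
  have hm : ∑ i, m.1 i = k := (Finset.mem_piAntidiag.1 m.2).1
  refine Nat.pos_of_ne_zero fun h => ?_
  have := occCount_mul_prod_factorial k m.1 hm
  rw [h, zero_mul] at this
  exact k.factorial_ne_zero this.symm

/-- This ratio of multinomial coefficients accounts for the factor `√(1 + j_i)` in the cloner. -/
theorem occCount_single_add {r : ℕ} (i : Fin d) (j : Occupation d r) :
    occCount (r + 1) (Pi.single i 1 + j.1) * (j.1 i + 1) = (r + 1) * occCount r j.1 := by
  have hj : ∑ l, j.1 l = r := (Finset.mem_piAntidiag.1 j.2).1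
  have h1 := occCount_mul_prod_factorial r j.1 hj
  have h2 := occCount_mul_prod_factorial (r + 1) (Pi.single i 1 + j.1)
    (by simp [Finset.sum_add_distrib, hj, add_comm])
  rw [prod_factorial_single_add, Nat.factorial_succ, ← h1, ← mul_assoc, ← mul_assoc] at h2
  exact Nat.eq_of_mul_eq_mul_right (Finset.prod_pos fun l _ => Nat.factorial_pos _) h2

/-- The isometric embedding of the symmetric subspace into the tensor power. -/
noncomputable def symEmbed (d k : ℕ) : Matrix (Fin k → Fin d) (Occupation d k) ℂ :=
  Matrix.of fun f m => if occ f = m.1 then (((√(occCount k m.1))⁻¹ : ℝ) : ℂ) else 0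

theorem symEmbed_apply {k : ℕ} (f : Fin k → Fin d) (m : Occupation d k) :
    symEmbed d k f m = if occ f = m.1 then (((√(occCount k m.1))⁻¹ : ℝ) : ℂ) else 0 := rfl

theorem symEmbed_conjTranspose_apply {k : ℕ} (f : Fin k → Fin d) (m : Occupation d k) :
    (symEmbed d k)ᴴ m f = symEmbed d k f m := by
  rw [conjTranspose_apply, symEmbed_apply]
  split_ifs <;> simp

theorem sum_occCount_mul {k : ℕ} (m : Fin d → ℕ) (c : ℂ) :
    ∑ f : Fin k → Fin d, (if occ f = m then c else 0) = occCount k m * c := by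
  rw [← Finset.sum_filter, Finset.sum_const, occCount, nsmul_eq_mul]

theorem occCount_inv_sqrt_mul {k : ℕ} (m : Occupation d k) :
    (((√(occCount k m.1))⁻¹ : ℝ) : ℂ) * (((√(occCount k m.1))⁻¹ : ℝ) : ℂ) =
      (occCount k m.1 : ℂ)⁻¹ := by
  rw [← Complex.ofReal_mul, ← mul_inv, Real.mul_self_sqrt (Nat.cast_nonneg _)]
  simp

theorem symEmbed_isometry (k : ℕ) : (symEmbed d k)ᴴ * symEmbed d k = 1 := by
  ext m m'
  rw [mul_apply]
  simp only [symEmbed_conjTranspose_apply, symEmbed_apply]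
  by_cases h : m = m'
  · subst h
    have : ∀ f : Fin k → Fin d, ((if occ f = m.1 then (((√(occCount k m.1))⁻¹ : ℝ) : ℂ) else 0) *
        if occ f = m.1 then (((√(occCount k m.1))⁻¹ : ℝ) : ℂ) else 0) =
        if occ f = m.1 then (occCount k m.1 : ℂ)⁻¹ else 0 := by
      intro f
      split_ifs
      · exact occCount_inv_sqrt_mul m
      · simp
    rw [Finset.sum_congr rfl fun f _ => this f, sum_occCount_mul, one_apply_eq]
    exact mul_inv_cancel₀ (by exact_mod_cast (occCount_pos m).ne')
  · rw [one_apply_ne h]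
    refine Finset.sum_eq_zero fun f _ => ?_
    by_cases h1 : occ f = m.1
    · have : occ f ≠ m'.1 := fun h2 => h (Subtype.ext (h1.symm.trans h2))
      simp [this]
    · simp [h1]

/-- `S S†` averages over the sequences sharing an occupation vector, so it fixes columns constant on
these classes. -/
theorem symEmbed_proj_mul {k : ℕ} {ι : Type*} {G : Matrix (Fin k → Fin d) ι ℂ}
    (hG : ∀ f g l, occ f = occ g → G f l = G g l) :
    symEmbed d k * (symEmbed d k)ᴴ * G = G := by
  ext f l
  have hmem : occ f ∈ Finset.piAntidiag (Finset.univ : Finset (Fin d)) k :=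
    Finset.mem_piAntidiag.2 ⟨sum_occ f, by simp⟩
  rw [Matrix.mul_assoc, mul_apply, Finset.sum_eq_single ⟨occ f, hmem⟩]
  · have : ∀ g, (symEmbed d k)ᴴ ⟨occ f, hmem⟩ g * G g l =
        if occ g = occ f then (((√(occCount k (occ f)))⁻¹ : ℝ) : ℂ) * G f l else 0 := by
      intro g
      rw [symEmbed_conjTranspose_apply, symEmbed_apply]
      split_ifs with h
      · rw [hG g f l h]
      · simp
    rw [mul_apply, Finset.sum_congr rfl fun g _ => this g, sum_occCount_mul, symEmbed_apply,
      if_pos rfl, mul_left_comm, ← mul_assoc (((√_)⁻¹ : ℝ) : ℂ), occCount_inv_sqrt_mul ⟨occ f, hmem⟩,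
      ← mul_assoc, mul_inv_cancel₀, one_mul]
    exact_mod_cast (occCount_pos ⟨occ f, hmem⟩).ne'
  · intro m _ hm
    rw [symEmbed_apply, if_neg fun h => hm (Subtype.ext h.symm), zero_mul]
  · simp

/-- The tensor power of a matrix. -/
def tensorPow (k : ℕ) (W : Matrix (Fin d) (Fin d) ℂ) :
    Matrix (Fin k → Fin d) (Fin k → Fin d) ℂ :=
  Matrix.of fun f g => ∏ a, W (f a) (g a)

theorem tensorPow_conjTranspose (k : ℕ) (W : Matrix (Fin d) (Fin d) ℂ) :
    (tensorPow k W)ᴴ = tensorPow k Wᴴ := by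
  ext f g
  simp [tensorPow]

theorem tensorPow_mul (k : ℕ) (W W' : Matrix (Fin d) (Fin d) ℂ) :
    tensorPow k W * tensorPow k W' = tensorPow k (W * W') := by
  ext f g
  simp only [tensorPow, mul_apply, of_apply, ← Finset.prod_mul_distrib]
  rw [Finset.prod_univ_sum]
  simp

theorem tensorPow_one (k : ℕ) : tensorPow k (1 : Matrix (Fin d) (Fin d) ℂ) = 1 := by
  ext f g
  by_cases h : f = g
  · subst h
    simp [tensorPow]
  · obtain ⟨a, ha⟩ := Function.ne_iff.1 h
    rw [one_apply_ne h]
    exact Finset.prod_eq_zero (Finset.mem_univ a) (one_apply_ne ha)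

/-- Sequences with equal occupation differ by a permutation of positions; permuting the summation
index in the same way leaves the product of entries of `W` and the occupation vector unchanged. -/
theorem symEmbed_proj_tensorPow {k : ℕ} (W : Matrix (Fin d) (Fin d) ℂ) :
    symEmbed d k * (symEmbed d k)ᴴ * (tensorPow k W * symEmbed d k) =
      tensorPow k W * symEmbed d k := by
  refine symEmbed_proj_mul fun f g m h => ?_
  obtain ⟨σ, rfl⟩ := exists_perm_of_occ_eq h
  rw [mul_apply, mul_apply, ← (Equiv.arrowCongr σ.symm (Equiv.refl (Fin d))).sum_comp]
  refine Finset.sum_congr rfl fun q _ => ?_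
  have h1 : (Equiv.arrowCongr σ.symm (Equiv.refl (Fin d))) q = q ∘ σ := rfl
  rw [h1, symEmbed_apply, symEmbed_apply, occ_comp_perm]
  congr 1
  exact Equiv.prod_comp σ fun a => W (g a) (q a)

/-- The operator `ρ ⊗ 1` on the `(r + 1)`-st tensor power. -/
def liftFirst (r : ℕ) (ρ : Matrix (Fin d) (Fin d) ℂ) :
    Matrix (Fin (r + 1) → Fin d) (Fin (r + 1) → Fin d) ℂ :=
  (ρ ⊗ₖ (1 : Matrix (Fin r → Fin d) (Fin r → Fin d) ℂ)).submatrix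
    (Fin.consEquiv fun _ => Fin d).symm (Fin.consEquiv fun _ => Fin d).symm

theorem tensorPow_succ (r : ℕ) (W : Matrix (Fin d) (Fin d) ℂ) :
    tensorPow (r + 1) W = (W ⊗ₖ tensorPow r W).submatrix
      (Fin.consEquiv fun _ => Fin d).symm (Fin.consEquiv fun _ => Fin d).symm := by
  ext f g
  simp only [tensorPow, of_apply, submatrix_apply, kroneckerMap_apply, Fin.prod_univ_succ]
  rfl

theorem tensorPow_conj_liftFirst (r : ℕ) {W : Matrix (Fin d) (Fin d) ℂ} (hW : W * Wᴴ = 1)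
    (ρ : Matrix (Fin d) (Fin d) ℂ) :
    tensorPow (r + 1) W * liftFirst r ρ * (tensorPow (r + 1) W)ᴴ =
      liftFirst r (W * ρ * Wᴴ) := by
  rw [tensorPow_conjTranspose, tensorPow_succ, tensorPow_succ, liftFirst, liftFirst,
    submatrix_mul_equiv, submatrix_mul_equiv, ← mul_kronecker_mul, ← mul_kronecker_mul,
    mul_one, tensorPow_mul, hW, tensorPow_one]

theorem liftFirst_one (r : ℕ) : liftFirst r (1 : Matrix (Fin d) (Fin d) ℂ) = 1 := by
  rw [liftFirst, one_kronecker_one, submatrix_one_equiv]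

end Cloner

/-! ### The cloner as a compression, and its covariance -/

section Covariance

open Matrix

variable {d : ℕ}

/-- The matrix entries of the creation operators, in the normalization of `symEmbed`. -/
noncomputable def creationCoeff (r : ℕ) (m : Occupation d (r + 1)) (i : Fin d) (j : Fin d → ℕ) : ℂ :=
  if Pi.single i 1 + j = m.1 then (((√(occCount (r + 1) m.1))⁻¹ : ℝ) : ℂ) else 0

theorem star_creationCoeff (r : ℕ) (m : Occupation d (r + 1)) (i : Fin d) (j : Fin d → ℕ) :
    star (creationCoeff r m i j) = creationCoeff r m i j := by
  rw [creationCoeff]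
  split_ifs <;> simp

theorem prod_single_add_factorial_div (i : Fin d) (j : Fin d → ℕ) :
    ∏ l, ((((Pi.single i 1 : Fin d → ℕ) l + j l)! : ℝ) /
      (((Pi.single i 1 : Fin d → ℕ) l)! * (j l)! : ℝ)) = j i + 1 := by
  have h1 : ∀ l, ((Pi.single i 1 : Fin d → ℕ) l)! = 1 := by
    intro l
    by_cases hl : l = i
    · subst hl; simp
    · simp [hl]
  have h2 : (∏ l, (((Pi.single i 1 : Fin d → ℕ) l + j l)! : ℝ)) = (j i + 1) * ∏ l, ((j l)! : ℝ) := by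
    exact_mod_cast prod_factorial_single_add i j
  simp only [h1, Nat.cast_one, one_mul, Finset.prod_div_distrib, h2]
  exact mul_div_cancel_right₀ _
    (Finset.prod_ne_zero_iff.2 fun l _ => by exact_mod_cast (j l).factorial_ne_zero)

/-- By the multinomial ratio, `√(1 + j_i)` is `√(r + 1)` times `√(occCount r j)` over `√(occCount (r
+ 1) m)`. The dependence on `i` survives only in the support condition, and `κ` depends on `d` and
`r` alone. -/
theorem exists_cloningIsometry_apply (d r : ℕ) : ∃ κ : ℝ, ∀ (m : Occupation d (r + 1))
    (j : Occupation d r) (i : Fin d), cloningIsometry d (r + 1) (m, j) i =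
      ((κ * √(occCount r j.1) : ℝ) : ℂ) * creationCoeff r m i j.1 := by
  refine ⟨√(((r + 1 - 1)! * (1 + d - 1)! : ℝ) / ((r + 1 + d - 1)! : ℝ)) * √(r + 1), ?_⟩
  intro m j i
  simp only [cloningIsometry, of_apply, creationCoeff, eq_comm (a := m.1)]
  split_ifs with h
  · rw [cloningCoeff, prod_single_add_factorial_div, ← Complex.ofReal_mul]
    congr 1
    rw [mul_assoc, mul_assoc]
    congr 1
    have hpos : (0 : ℝ) < occCount (r + 1) m.1 := by exact_mod_cast occCount_pos m
    rw [eq_comm, ← mul_assoc, ← div_eq_mul_inv, div_eq_iff (Real.sqrt_ne_zero'.2 hpos),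
      ← Real.sqrt_mul (by positivity), ← Real.sqrt_mul (by positivity), ← h]
    congr 1
    have := occCount_single_add i j
    rw [mul_comm] at this
    exact_mod_cast this.symm
  · simp

theorem sum_comp_occ {r : ℕ} (g : (Fin d → ℕ) → ℂ) :
    ∑ t : Fin r → Fin d, g (occ t) = ∑ j : Occupation d r, (occCount r j.1 : ℂ) * g j.1 := by
  let F : (Fin r → Fin d) → Occupation d r := fun t =>
    ⟨occ t, Finset.mem_piAntidiag.2 ⟨sum_occ t, by simp⟩⟩
  rw [← Finset.sum_fiberwise Finset.univ F]
  refine Finset.sum_congr rfl fun j _ => ?_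
  have : ∀ t ∈ Finset.univ.filter (fun t => F t = j), g (occ t) = g j.1 := by
    intro t ht
    rw [← (Finset.mem_filter.1 ht).2]
  rw [Finset.sum_congr rfl this, Finset.sum_const, nsmul_eq_mul, occCount]
  simp only [F, Subtype.ext_iff]

/-- Splitting off the first letter, the identity on the other `r` letters forces both sequences to
have the same tail `t`. -/
theorem symEmbed_conj_liftFirst_apply (r : ℕ) (ρ : Matrix (Fin d) (Fin d) ℂ)
    (m m' : Occupation d (r + 1)) :
    ((symEmbed d (r + 1))ᴴ * liftFirst r ρ * symEmbed d (r + 1)) m m' =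
      ∑ t : Fin r → Fin d, ∑ i', ∑ i,
        creationCoeff r m i (occ t) * ρ i i' * creationCoeff r m' i' (occ t) := by
  have hS : ∀ (m : Occupation d (r + 1)) (q : Fin d × (Fin r → Fin d)),
      symEmbed d (r + 1) ((Fin.consEquiv fun _ => Fin d) q) m =
        creationCoeff r m q.1 (occ q.2) := by
    intro m q
    rw [symEmbed_apply, creationCoeff, ← occ_cons]
    rfl
  simp only [mul_apply, symEmbed_conjTranspose_apply, Finset.sum_mul]
  rw [← (Fin.consEquiv fun _ => Fin d).sum_comp, Fintype.sum_prod_type_right]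
  refine Finset.sum_congr rfl fun t _ => Finset.sum_congr rfl fun i' _ => ?_
  rw [← (Fin.consEquiv fun _ => Fin d).sum_comp, Fintype.sum_prod_type]
  refine Finset.sum_congr rfl fun i _ => ?_
  rw [Finset.sum_eq_single t]
  · simp [hS, liftFirst]
  · intro t' _ ht
    simp [liftFirst, ht]
  · simp

/-- Tracing out `R` sums over `j` with weight `κ² occCount r j`, which is `κ²` times a sum over all
tails with occupation `j`: the partial trace becomes the identity on the last `r` factors. -/
theorem exists_cloningChannel_eq (d r : ℕ) : ∃ c : ℂ, ∀ ρ : Matrix (Fin d) (Fin d) ℂ,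
    cloningChannel d (r + 1) ρ =
      c • ((symEmbed d (r + 1))ᴴ * liftFirst r ρ * symEmbed d (r + 1)) := by
  obtain ⟨κ, hκ⟩ := exists_cloningIsometry_apply d r
  refine ⟨(κ : ℂ) ^ 2, fun ρ => ?_⟩
  ext m m'
  rw [Matrix.smul_apply, symEmbed_conj_liftFirst_apply, sum_comp_occ fun j =>
    ∑ i', ∑ i, creationCoeff r m i j * ρ i i' * creationCoeff r m' i' j, smul_eq_mul,
    Finset.mul_sum]
  change ∑ j : Occupation d r, (cloningIsometry d (r + 1) * ρ * (cloningIsometry d (r + 1))ᴴ)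
    (m, j) (m', j) = _
  refine Finset.sum_congr rfl fun j _ => ?_
  rw [mul_apply]
  simp only [mul_apply, conjTranspose_apply, hκ, Finset.mul_sum, Finset.sum_mul]
  refine Finset.sum_congr rfl fun i' _ => Finset.sum_congr rfl fun i _ => ?_
  have hsq : ((√(occCount r j.1) : ℝ) : ℂ) * ((√(occCount r j.1) : ℝ) : ℂ) = occCount r j.1 := by
    rw [← Complex.ofReal_mul, Real.mul_self_sqrt (Nat.cast_nonneg _), Complex.ofReal_natCast]
  rw [star_mul', star_creationCoeff, ← hsq]
  simp only [Complex.star_def, Complex.ofReal_mul, map_mul, Complex.conj_ofReal]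
  ring

/-- The cloning channel is covariant under unitaries. -/
theorem cloningChannel_covariant {k : ℕ} (hk : 1 ≤ k) {W : Matrix (Fin d) (Fin d) ℂ}
    (hW : W * Wᴴ = 1) : ∃ Q : Matrix (Occupation d k) (Occupation d k) ℂ, Qᴴ * Q = 1 ∧
      ∀ ρ, cloningChannel d k (W * ρ * Wᴴ) = Q * cloningChannel d k ρ * Qᴴ := by
  obtain ⟨r, rfl⟩ := Nat.exists_eq_add_of_le' hk
  obtain ⟨c, hc⟩ := exists_cloningChannel_eq d r
  set S := symEmbed d (r + 1) with hS
  set T := tensorPow (r + 1) W with hT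
  have hS1 : Sᴴ * S = 1 := symEmbed_isometry (r + 1)
  have hT1 : T * Tᴴ = 1 := by
    rw [hT, tensorPow_conjTranspose, tensorPow_mul, hW, tensorPow_one]
  -- The range of `S` is invariant under tensor powers. Applied to `W†` and then adjoined, this
  -- allows `S S†` to be inserted on both sides of `ρ ⊗ 1`, so that `Q = S† T S` is unitary and
  -- implements the covariance.
  have hP : ∀ W' : Matrix (Fin d) (Fin d) ℂ, S * (Sᴴ * (tensorPow (r + 1) W' * S)) = tensorPow (r + 1) W' * S := fun W' => by
    rw [← Matrix.mul_assoc]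
    exact symEmbed_proj_tensorPow W'
  have hT2 : S * (Sᴴ * (Tᴴ * S)) = Tᴴ * S := by
    rw [hT, tensorPow_conjTranspose]
    exact hP _
  have hT3 : Sᴴ * T * S * Sᴴ = Sᴴ * T := by
    have := congrArg conjTranspose hT2
    simpa [conjTranspose_mul, Matrix.mul_assoc] using this
  refine ⟨Sᴴ * T * S, ?_, fun ρ => ?_⟩
  · refine mul_eq_one_comm.1 ?_
    calc Sᴴ * T * S * (Sᴴ * T * S)ᴴ = Sᴴ * T * (S * (Sᴴ * (Tᴴ * S))) := by
          simp only [conjTranspose_mul, conjTranspose_conjTranspose, Matrix.mul_assoc]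
      _ = Sᴴ * (T * Tᴴ) * S := by rw [hT2]; simp only [Matrix.mul_assoc]
      _ = 1 := by rw [hT1, Matrix.mul_one, hS1]
  · rw [hc, hc, Matrix.mul_smul, Matrix.smul_mul, ← tensorPow_conj_liftFirst r hW]
    congr 1
    calc Sᴴ * (T * liftFirst r ρ * Tᴴ) * S
        = (Sᴴ * T) * liftFirst r ρ * (Tᴴ * S) := by simp only [Matrix.mul_assoc]
      _ = (Sᴴ * T * S * Sᴴ) * liftFirst r ρ * (S * (Sᴴ * (Tᴴ * S))) := by rw [hT2, hT3]
      _ = Sᴴ * T * S * (Sᴴ * liftFirst r ρ * S) * (Sᴴ * T * S)ᴴ := by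
          simp only [conjTranspose_mul, conjTranspose_conjTranspose, Matrix.mul_assoc]

theorem exists_cloningChannel_one {k : ℕ} (hk : 1 ≤ k) :
    ∃ c : ℂ, cloningChannel d k (1 : Matrix (Fin d) (Fin d) ℂ) = c • 1 := by
  obtain ⟨r, rfl⟩ := Nat.exists_eq_add_of_le' hk
  obtain ⟨c, hc⟩ := exists_cloningChannel_eq d r
  exact ⟨c, by rw [hc, liftFirst_one, Matrix.mul_one, symEmbed_isometry]⟩

end Covariance

set_option linter.unusedSectionVars false

/-! ### Partial traces and the entropy of the environment -/

section Objective

open Matrix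
open scoped ComplexOrder

variable {d : ℕ} {B E E' : Type*} [Fintype B] [Fintype E] [Fintype E']

/-- The partial trace over the first tensor factor. -/
def traceFirst (M : Matrix (B × E) (B × E) ℂ) : Matrix E E ℂ :=
  Matrix.of fun e e' => ∑ b, M (b, e) (b, e')

theorem traceSecond_sum {ι : Type*} (s : Finset ι) (M : ι → Matrix (B × E) (B × E) ℂ) :
    traceSecond (∑ i ∈ s, M i) = ∑ i ∈ s, traceSecond (M i) := by
  ext b b'
  simp only [traceSecond, of_apply, Matrix.sum_apply]
  exact Finset.sum_comm

theorem traceFirst_sum {ι : Type*} (s : Finset ι) (M : ι → Matrix (B × E) (B × E) ℂ) :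
    traceFirst (∑ i ∈ s, M i) = ∑ i ∈ s, traceFirst (M i) := by
  ext b b'
  simp only [traceFirst, of_apply, Matrix.sum_apply]
  exact Finset.sum_comm

theorem traceSecond_smul (c : ℂ) (M : Matrix (B × E) (B × E) ℂ) :
    traceSecond (c • M) = c • traceSecond M := by
  ext b b'
  simp [traceSecond, Finset.mul_sum]

theorem traceFirst_smul (c : ℂ) (M : Matrix (B × E) (B × E) ℂ) :
    traceFirst (c • M) = c • traceFirst M := by
  ext b b'
  simp [traceFirst, Finset.mul_sum]

theorem trace_traceSecond (M : Matrix (B × E) (B × E) ℂ) : (traceSecond M).trace = M.trace := by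
  simp [traceSecond, trace, Fintype.sum_prod_type]

theorem trace_traceFirst (M : Matrix (B × E) (B × E) ℂ) : (traceFirst M).trace = M.trace := by
  simp [traceFirst, trace, Fintype.sum_prod_type_right]

theorem Matrix.PosSemidef.traceSecond {M : Matrix (B × E) (B × E) ℂ} (hM : M.PosSemidef) :
    (traceSecond M).PosSemidef := by
  have h : _root_.traceSecond M = ∑ e, M.submatrix (fun b => (b, e)) (fun b => (b, e)) := by
    ext b b'
    simp [_root_.traceSecond, Matrix.sum_apply]
  rw [h]
  exact posSemidef_sum _ fun e _ => hM.submatrix _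

theorem Matrix.PosSemidef.traceFirst {M : Matrix (B × E) (B × E) ℂ} (hM : M.PosSemidef) :
    (traceFirst M).PosSemidef := by
  have h : _root_.traceFirst M = ∑ b, M.submatrix (fun e => (b, e)) (fun e => (b, e)) := by
    ext b b'
    simp [_root_.traceFirst, Matrix.sum_apply]
  rw [h]
  exact posSemidef_sum _ fun e _ => hM.submatrix _

theorem traceSecond_kronecker_conj [DecidableEq E] (Q : Matrix B B ℂ)
    (M : Matrix (B × E) (B × E) ℂ) :
    traceSecond ((Q ⊗ₖ (1 : Matrix E E ℂ)) * M * (Q ⊗ₖ (1 : Matrix E E ℂ))ᴴ) =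
      Q * traceSecond M * Qᴴ := by
  ext b b'
  simp only [traceSecond, of_apply, mul_apply, conjTranspose_apply, kroneckerMap_apply,
    Fintype.sum_prod_type, one_apply, mul_ite, ite_mul, mul_one, mul_zero, zero_mul,
    Finset.sum_ite_eq, Finset.mem_univ, if_true, apply_ite star, star_zero, Finset.sum_mul,
    Finset.mul_sum]
  rw [Finset.sum_comm]
  refine Finset.sum_congr rfl fun x _ => ?_
  rw [Finset.sum_comm]

theorem traceFirst_kronecker_conj [DecidableEq E] [DecidableEq B] {Q : Matrix B B ℂ}
    (hQ : Qᴴ * Q = 1) (M : Matrix (B × E) (B × E) ℂ) :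
    traceFirst ((Q ⊗ₖ (1 : Matrix E E ℂ)) * M * (Q ⊗ₖ (1 : Matrix E E ℂ))ᴴ) = traceFirst M := by
  ext e e'
  have h : ∀ x y, ∑ b, Q b x * star (Q b y) = if x = y then 1 else 0 := by
    intro x y
    have := congrFun (congrFun hQ y) x
    rw [mul_apply, one_apply] at this
    simp only [conjTranspose_apply] at this
    rw [← if_congr eq_comm rfl rfl, ← this]
    exact Finset.sum_congr rfl fun b _ => mul_comm _ _
  have h' : ∀ b, ((Q ⊗ₖ (1 : Matrix E E ℂ)) * M * (Q ⊗ₖ (1 : Matrix E E ℂ))ᴴ) (b, e) (b, e') =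
      ∑ y, ∑ x, M (x, e) (y, e') * (Q b x * star (Q b y)) := by
    intro b
    simp only [mul_apply, conjTranspose_apply, kroneckerMap_apply,
      Fintype.sum_prod_type, one_apply, mul_ite, ite_mul, mul_one, mul_zero, zero_mul,
      Finset.sum_ite_eq, Finset.mem_univ, if_true, apply_ite star, star_zero, Finset.sum_mul]
    refine Finset.sum_congr rfl fun y _ => Finset.sum_congr rfl fun x _ => ?_
    ring
  simp only [traceFirst, of_apply, h']
  rw [Finset.sum_comm]
  refine Finset.sum_congr rfl fun y _ => ?_
  rw [Finset.sum_comm]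
  simp only [← Finset.mul_sum, h]
  simp

variable [DecidableEq B] [DecidableEq E] [DecidableEq E']

/-- Reshape `U L` into a matrix `K` with rows indexed by `E`. Then `K K†` is the state of `E`, while
the entries of `K† K` are channel outputs at `L |i⟩⟨j| L†`. Matrix units are not states, so the
channel has to be known on all matrices. -/
theorem vonNeumannEntropy_traceFirst_eq_channel (U : Matrix (B × E) (Fin d) ℂ)
    (L : Matrix (Fin d) (Fin d) ℂ) :
    vonNeumannEntropy (traceFirst (U * (L * Lᴴ) * Uᴴ)) =
      vonNeumannEntropy (Matrix.of fun s t : B × Fin d =>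
        traceSecond (U * (L * single t.2 s.2 (1 : ℂ) * Lᴴ) * Uᴴ) t.1 s.1) := by
  let K : Matrix E (B × Fin d) ℂ := Matrix.of fun e s => (U * L) (s.1, e) s.2
  have h1 : traceFirst (U * (L * Lᴴ) * Uᴴ) = K * Kᴴ := by
    have : U * (L * Lᴴ) * Uᴴ = (U * L) * (U * L)ᴴ := by
      simp only [conjTranspose_mul, Matrix.mul_assoc]
    rw [this]
    ext e e'
    simp only [traceFirst, of_apply, mul_apply (N := (U * L)ᴴ), mul_apply (N := Kᴴ), K,
      conjTranspose_apply, Fintype.sum_prod_type]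
  rw [h1, vonNeumannEntropy_mul_conjTranspose_comm]
  congr 1
  ext s t
  have : U * (L * single t.2 s.2 (1 : ℂ) * Lᴴ) * Uᴴ =
      (U * L) * single t.2 s.2 (1 : ℂ) * (U * L)ᴴ := by
    simp only [conjTranspose_mul, Matrix.mul_assoc]
  rw [of_apply, this]
  simp only [traceSecond, of_apply, mul_apply (M := Kᴴ), K, conjTranspose_apply]
  refine Finset.sum_congr rfl fun e _ => ?_
  rw [mul_apply (N := (U * L)ᴴ), Finset.sum_eq_single s.2]
  · rw [mul_single_apply_same, conjTranspose_apply, mul_one, mul_comm]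
  · intro i _ hi
    rw [mul_single_apply_of_ne _ _ _ _ _ hi, zero_mul]
  · simp

/-- The entropy of the complementary output depends only on the channel. -/
theorem vonNeumannEntropy_traceFirst_eq {U : Matrix (B × E) (Fin d) ℂ}
    {V : Matrix (B × E') (Fin d) ℂ}
    (h : ∀ ρ : Matrix (Fin d) (Fin d) ℂ, traceSecond (U * ρ * Uᴴ) = traceSecond (V * ρ * Vᴴ))
    (L : Matrix (Fin d) (Fin d) ℂ) :
    vonNeumannEntropy (traceFirst (U * (L * Lᴴ) * Uᴴ)) =
      vonNeumannEntropy (traceFirst (V * (L * Lᴴ) * Vᴴ)) := by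
  rw [vonNeumannEntropy_traceFirst_eq_channel, vonNeumannEntropy_traceFirst_eq_channel]
  simp only [h]

/-- By covariance `U W` and `(Q ⊗ 1) U` induce the same channel, hence give `E` the same entropy;
and `Q`, acting on `B` only, disappears under the trace over `B`. -/
theorem vonNeumannEntropy_traceFirst_conj {U : Matrix (B × E) (Fin d) ℂ}
    {W : Matrix (Fin d) (Fin d) ℂ} {Q : Matrix B B ℂ} (hQ : Qᴴ * Q = 1)
    (h : ∀ ρ : Matrix (Fin d) (Fin d) ℂ,
      traceSecond (U * (W * ρ * Wᴴ) * Uᴴ) = Q * traceSecond (U * ρ * Uᴴ) * Qᴴ)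
    (L : Matrix (Fin d) (Fin d) ℂ) :
    vonNeumannEntropy (traceFirst (U * (W * (L * Lᴴ) * Wᴴ) * Uᴴ)) =
      vonNeumannEntropy (traceFirst (U * (L * Lᴴ) * Uᴴ)) := by
  have h1 : ∀ ρ : Matrix (Fin d) (Fin d) ℂ, U * (W * ρ * Wᴴ) * Uᴴ = (U * W) * ρ * (U * W)ᴴ := fun ρ => by
    simp only [conjTranspose_mul, Matrix.mul_assoc]
  have h2 : ∀ ρ : Matrix (Fin d) (Fin d) ℂ, ((Q ⊗ₖ (1 : Matrix E E ℂ)) * U) * ρ * ((Q ⊗ₖ (1 : Matrix E E ℂ)) * U)ᴴ =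
      (Q ⊗ₖ (1 : Matrix E E ℂ)) * (U * ρ * Uᴴ) * (Q ⊗ₖ (1 : Matrix E E ℂ))ᴴ := fun ρ => by
    rw [conjTranspose_mul]
    simp only [Matrix.mul_assoc]
  rw [h1, vonNeumannEntropy_traceFirst_eq (V := (Q ⊗ₖ (1 : Matrix E E ℂ)) * U) _ L, h2,
    traceFirst_kronecker_conj hQ]
  intro ρ
  rw [← h1, h2, h, traceSecond_kronecker_conj]

/-- The contribution of a conditional input state to the private dynamic capacity formula. -/
noncomputable def conditionalGain (U : Matrix (B × E) (Fin d) ℂ) (lam mu : ℝ)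
    (ρ : Matrix (Fin d) (Fin d) ℂ) : ℝ :=
  lam * (vonNeumannEntropy (traceSecond (U * ρ * Uᴴ)) -
    vonNeumannEntropy (traceFirst (U * ρ * Uᴴ))) -
  mu * vonNeumannEntropy (traceFirst (U * ρ * Uᴴ))

/-- The density matrix of a pure state of an ensemble. -/
def PureEnsemble.density {X Y : Type*} [Fintype X] [Fintype Y] (ens : PureEnsemble X Y d)
    (x : X) (y : Y) : Matrix (Fin d) (Fin d) ℂ :=
  vecMulVec (ens.state x y) (star (ens.state x y))

theorem PureEnsemble.trace_density {X Y : Type*} [Fintype X] [Fintype Y]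
    (ens : PureEnsemble X Y d) (x : X) (y : Y) :
    (ens.density x y).trace = 1 := by
  rw [density, trace_vecMulVec, dotProduct]
  simp only [Pi.star_apply, Complex.star_def, Complex.mul_conj']
  exact_mod_cast ens.state_unit x y

theorem PureEnsemble.density_posSemidef {X Y : Type*} [Fintype X] [Fintype Y]
    (ens : PureEnsemble X Y d) (x : X) (y : Y) :
    (ens.density x y).PosSemidef := posSemidef_vecMulVec_self_star _

/-! ### The objective as a combination of output entropies -/

section Marginals

variable {X Y : Type*} [Fintype X] [Fintype Y] [DecidableEq X] [DecidableEq Y]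

theorem outputState_apply (U : Matrix (B × E) (Fin d) ℂ) (ens : PureEnsemble X Y d)
    (x x' : X) (y y' : Y) (s t : B × E) :
    outputState U ens (x, y, s) (x', y', t) =
      if x = x' then if y = y' then (ens.prob x y : ℂ) * (U * ens.density x y * Uᴴ) s t
      else 0 else 0 := by
  simp only [outputState, Matrix.sum_apply, Matrix.smul_apply, kroneckerMap_apply, single_apply,
    smul_eq_mul, PureEnsemble.density]
  rw [Finset.sum_eq_single x, Finset.sum_eq_single y]
  · by_cases hx : x = x' <;> by_cases hy : y = y' <;> simp [hx, hy]
  · intro z _ hz; simp [hz]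
  · simp
  · intro z _ hz; simp [hz]
  · simp

theorem sum_isometry_conj_diag {U : Matrix (B × E) (Fin d) ℂ} (hU : Uᴴ * U = 1)
    (ρ : Matrix (Fin d) (Fin d) ℂ) : ∑ b, ∑ e, (U * ρ * Uᴴ) (b, e) (b, e) = ρ.trace := by
  rw [← Fintype.sum_prod_type (f := fun s => (U * ρ * Uᴴ) s s)]
  change (U * ρ * Uᴴ).trace = _
  rw [trace_mul_comm, ← Matrix.mul_assoc, hU, Matrix.one_mul]

variable (U : Matrix (B × E) (Fin d) ℂ) (ens : PureEnsemble X Y d)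

theorem marginalXY_outputState (hU : Uᴴ * U = 1) : marginalXY (outputState U ens) =
    diagonal fun s => ((ens.prob s.1 s.2 : ℝ) : ℂ) := by
  ext ⟨x, y⟩ ⟨x', y'⟩
  simp only [marginalXY, of_apply, outputState_apply, diagonal_apply, Prod.mk.injEq]
  by_cases hx : x = x' <;> by_cases hy : y = y' <;>
    simp [hx, hy, ← Finset.mul_sum, sum_isometry_conj_diag hU, ens.trace_density]

theorem marginalX_outputState (hU : Uᴴ * U = 1) : marginalX (outputState U ens) =
    diagonal fun x => ((∑ y, ens.prob x y : ℝ) : ℂ) := by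
  ext x x'
  simp only [marginalX, of_apply, outputState_apply, diagonal_apply]
  by_cases hx : x = x' <;>
    simp [hx, ← Finset.mul_sum, sum_isometry_conj_diag hU, ens.trace_density]

theorem marginalXYB_outputState : marginalXYB (outputState U ens) =
    directSum fun x => directSum fun y =>
      (ens.prob x y : ℂ) • traceSecond (U * ens.density x y * Uᴴ) := by
  ext ⟨x, y, b⟩ ⟨x', y', b'⟩
  simp only [marginalXYB, of_apply, outputState_apply, directSum]
  by_cases hx : x = x' <;> by_cases hy : y = y' <;>
    simp [hx, hy, traceSecond, Finset.mul_sum]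

theorem conj_sum_smul {ι : Type*} (s : Finset ι) (c : ι → ℂ)
    (ρ : ι → Matrix (Fin d) (Fin d) ℂ) :
    U * (∑ i ∈ s, c i • ρ i) * Uᴴ = ∑ i ∈ s, c i • (U * ρ i * Uᴴ) := by
  simp only [Matrix.mul_sum, Matrix.sum_mul, Matrix.mul_smul, Matrix.smul_mul]

theorem marginalXB_outputState : marginalXB (outputState U ens) =
    directSum fun x => traceSecond (U * (∑ y, (ens.prob x y : ℂ) • ens.density x y) * Uᴴ) := by
  ext ⟨x, b⟩ ⟨x', b'⟩
  simp only [marginalXB, of_apply, outputState_apply, directSum, conj_sum_smul, traceSecond_sum,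
    traceSecond_smul, Matrix.sum_apply]
  by_cases hx : x = x' <;> simp [hx, traceSecond, Finset.mul_sum]

theorem marginalXE_outputState : marginalXE (outputState U ens) =
    directSum fun x => traceFirst (U * (∑ y, (ens.prob x y : ℂ) • ens.density x y) * Uᴴ) := by
  ext ⟨x, b⟩ ⟨x', b'⟩
  simp only [marginalXE, of_apply, outputState_apply, directSum, conj_sum_smul, traceFirst_sum,
    traceFirst_smul, Matrix.sum_apply]
  by_cases hx : x = x' <;> simp [hx, traceFirst, Finset.mul_sum]

theorem marginalB_outputState : marginalB (outputState U ens) =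
    traceSecond (U * (∑ x, ∑ y, (ens.prob x y : ℂ) • ens.density x y) * Uᴴ) := by
  ext b b'
  rw [← Fintype.sum_prod_type' (f := fun x y => (ens.prob x y : ℂ) • ens.density x y),
    conj_sum_smul, traceSecond_sum]
  simp only [marginalB, of_apply, outputState_apply, traceSecond_smul, Matrix.sum_apply,
    Fintype.sum_prod_type]
  simp [traceSecond, Finset.mul_sum]

variable {U}

/-- The blocks have trace one, so scaling by `p x` adds exactly `negMulLog (p x)`, which the entropy
of the classical register cancels. -/
theorem sum_vonNeumannEntropy_smul {n : Type*} [Fintype n] [DecidableEq n] (p : X → ℝ)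
    {σ : X → Matrix n n ℂ} (hσ : ∀ x, (σ x).IsHermitian) (ht : ∀ x, (σ x).trace = 1) :
    vonNeumannEntropy (directSum fun x => (p x : ℂ) • σ x) -
      vonNeumannEntropy (diagonal fun x => (p x : ℂ)) = ∑ x, p x * vonNeumannEntropy (σ x) := by
  rw [vonNeumannEntropy_directSum, vonNeumannEntropy_diagonal, ← Finset.sum_sub_distrib]
  · refine Finset.sum_congr rfl fun x _ => ?_
    rw [vonNeumannEntropy_smul (hσ x), ht]
    simp
  · intro x
    rw [IsHermitian, conjTranspose_smul, hσ x]
    simp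

theorem directSum_directSum_entropy {n : Type*} [Fintype n] [DecidableEq n] (p : X → Y → ℝ)
    {σ : X → Y → Matrix n n ℂ} (hσ : ∀ x y, (σ x y).IsHermitian)
    (ht : ∀ x y, (σ x y).trace = 1) :
    vonNeumannEntropy (directSum fun x => directSum fun y => (p x y : ℂ) • σ x y) -
      vonNeumannEntropy (diagonal fun s : X × Y => (p s.1 s.2 : ℂ)) =
    ∑ x, ∑ y, p x y * vonNeumannEntropy (σ x y) := by
  have hs : ∀ x y, ((p x y : ℂ) • σ x y).IsHermitian := by
    intro x y
    rw [IsHermitian, conjTranspose_smul, hσ x y]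
    simp
  have hd : ∀ x, (directSum fun y => (p x y : ℂ) • σ x y).IsHermitian := by
    intro x
    ext s t
    simp only [directSum, conjTranspose_apply, of_apply]
    by_cases h : s.1 = t.1
    · rw [if_pos h, if_pos h.symm, h, ← conjTranspose_apply, hs]
    · rw [if_neg h, if_neg (Ne.symm h), star_zero]
  rw [vonNeumannEntropy_directSum hd, vonNeumannEntropy_diagonal, Fintype.sum_prod_type,
    ← Finset.sum_sub_distrib]
  refine Finset.sum_congr rfl fun x _ => ?_
  rw [← sum_vonNeumannEntropy_smul (p x) (hσ x) (ht x), vonNeumannEntropy_diagonal]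

/-- The states `σ x` are normalized conditional inputs. Asking for them only through `hens` avoids
dividing by `p(x)`, which may vanish. -/
theorem privateDynamicObjective_eq (hU : Uᴴ * U = 1) (lam mu : ℝ)
    {σ : X → Matrix (Fin d) (Fin d) ℂ} (hσ : ∀ x, (σ x).PosSemidef) (ht : ∀ x, (σ x).trace = 1)
    (hens : ∀ x, ∑ y, (ens.prob x y : ℂ) • ens.density x y = ((∑ y, ens.prob x y : ℝ) : ℂ) • σ x) :
    privateDynamicObjective U lam mu ens =
      (1 + mu) * vonNeumannEntropy
        (traceSecond (U * (∑ x, ∑ y, (ens.prob x y : ℂ) • ens.density x y) * Uᴴ))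
      - ∑ x, ∑ y, ens.prob x y * vonNeumannEntropy (traceSecond (U * ens.density x y * Uᴴ))
      + ∑ x, (∑ y, ens.prob x y) * conditionalGain U lam mu (σ x) := by
  have hpos : ∀ {ρ : Matrix (Fin d) (Fin d) ℂ}, ρ.PosSemidef → (U * ρ * Uᴴ).PosSemidef :=
    fun h => h.mul_mul_conjTranspose_same U
  have htr : ∀ ρ : Matrix (Fin d) (Fin d) ℂ, (U * ρ * Uᴴ).trace = ρ.trace := by
    intro ρ
    rw [trace_mul_comm, ← Matrix.mul_assoc, hU, Matrix.one_mul]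
  have h1 := directSum_directSum_entropy ens.prob
    (σ := fun x y => traceSecond (U * ens.density x y * Uᴴ))
    (fun x y => (hpos (ens.density_posSemidef x y)).traceSecond.isHermitian)
    (fun x y => by rw [trace_traceSecond, htr, ens.trace_density])
  have h2 := sum_vonNeumannEntropy_smul (fun x => ∑ y, ens.prob x y)
    (σ := fun x => traceSecond (U * σ x * Uᴴ)) (fun x => (hpos (hσ x)).traceSecond.isHermitian)
    (fun x => by rw [trace_traceSecond, htr, ht])
  have h3 := sum_vonNeumannEntropy_smul (fun x => ∑ y, ens.prob x y)
    (σ := fun x => traceFirst (U * σ x * Uᴴ)) (fun x => (hpos (hσ x)).traceFirst.isHermitian)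
    (fun x => by rw [trace_traceFirst, htr, ht])
  have h4 : ∑ x, (∑ y, ens.prob x y) * conditionalGain U lam mu (σ x) =
      lam * (∑ x, (∑ y, ens.prob x y) * vonNeumannEntropy (traceSecond (U * σ x * Uᴴ)) -
        ∑ x, (∑ y, ens.prob x y) * vonNeumannEntropy (traceFirst (U * σ x * Uᴴ))) -
      mu * ∑ x, (∑ y, ens.prob x y) * vonNeumannEntropy (traceFirst (U * σ x * Uᴴ)) := by
    rw [← Finset.sum_sub_distrib, Finset.mul_sum, Finset.mul_sum, ← Finset.sum_sub_distrib]
    refine Finset.sum_congr rfl fun x _ => ?_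
    rw [conditionalGain]
    ring
  rw [h4, ← h1, ← h2, ← h3, privateDynamicObjective, mutualInfoYXB, condEntropyBX, condEntropyEX,
    entropyB, marginalXY_outputState U ens hU, marginalX_outputState U ens hU,
    marginalXYB_outputState, marginalXB_outputState, marginalXE_outputState,
    marginalB_outputState]
  simp only [hens, Matrix.mul_smul, Matrix.smul_mul, traceSecond_smul, traceFirst_smul]
  ring

end Marginals

end Objective

/-! ### Upper bound and its attainment by cyclic shifts -/

section Maximum

open Matrix
open scoped ComplexOrder

variable {d k : ℕ}

/-- The diagonal density matrix with given weights. -/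
noncomputable def diagState (v : Fin d → ℝ) : Matrix (Fin d) (Fin d) ℂ :=
  diagonal fun i => (v i : ℂ)

theorem diagState_eq_mul_conjTranspose {v : Fin d → ℝ} (hv : ∀ i, 0 ≤ v i) :
    diagState v = diagState (fun i => √(v i)) * (diagState fun i => √(v i))ᴴ := by
  rw [diagState, diagState, diagonal_conjTranspose, diagonal_mul_diagonal]
  congr 1
  funext i
  rw [Pi.star_apply, Complex.star_def, Complex.conj_ofReal, ← Complex.ofReal_mul,
    Real.mul_self_sqrt (hv i)]

theorem diagState_posSemidef {v : Fin d → ℝ} (hv : ∀ i, 0 ≤ v i) : (diagState v).PosSemidef := by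
  rw [diagState_eq_mul_conjTranspose hv]
  exact posSemidef_self_mul_conjTranspose _

theorem trace_diagState {v : Fin d → ℝ} (hv : v ∈ stdSimplex ℝ (Fin d)) :
    (diagState v).trace = 1 := by
  rw [diagState, trace_diagonal]
  exact_mod_cast hv.2

theorem exists_conj_diagState {ρ : Matrix (Fin d) (Fin d) ℂ} (hρ : ρ.PosSemidef)
    (ht : ρ.trace = 1) : ∃ (W : Matrix (Fin d) (Fin d) ℂ) (v : Fin d → ℝ), Wᴴ * W = 1 ∧
      W * Wᴴ = 1 ∧ v ∈ stdSimplex ℝ (Fin d) ∧ ρ = W * diagState v * Wᴴ := by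
  obtain ⟨W, v, h1, h2, h3, hv⟩ := hρ.isHermitian.exists_conj_diagonal
  refine ⟨W, v, h1, h2, ⟨fun i => ?_, ?_⟩, h3⟩
  · rw [hv]
    exact hρ.eigenvalues_nonneg i
  · rw [h3, trace_mul_comm, ← Matrix.mul_assoc, h1, Matrix.one_mul, trace_diagonal] at ht
    exact_mod_cast ht

theorem exists_conj_diagState_comp (σ : Equiv.Perm (Fin d)) :
    ∃ W : Matrix (Fin d) (Fin d) ℂ, W * Wᴴ = 1 ∧
      ∀ v, diagState (v ∘ σ) = W * diagState v * Wᴴ := by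
  refine ⟨(1 : Matrix (Fin d) (Fin d) ℂ).submatrix σ id, ?_, fun v => ?_⟩
  · rw [conjTranspose_submatrix, conjTranspose_one]
    ext i j
    simp [mul_apply, one_apply, σ.injective.eq_iff]
  · ext i j
    simp only [diagState, mul_apply, submatrix_apply, conjTranspose_apply, id, diagonal_apply,
      one_apply, Function.comp_apply]
    by_cases h : i = j <;> simp [h]

section Extension

variable {E : Type*} [Fintype E] [DecidableEq E] {U : Matrix (Occupation d k × E) (Fin d) ℂ}

theorem cloningChannel_posSemidef {ρ : Matrix (Fin d) (Fin d) ℂ} (hρ : ρ.PosSemidef) :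
    (cloningChannel d k ρ).PosSemidef :=
  (hρ.mul_mul_conjTranspose_same _).traceSecond

theorem IsIsometricExtension.trace_cloningChannel (hU : IsIsometricExtension (cloningChannel d k) U)
    (ρ : Matrix (Fin d) (Fin d) ℂ) : (cloningChannel d k ρ).trace = ρ.trace := by
  rw [← hU.2, trace_traceSecond, trace_mul_comm, ← Matrix.mul_assoc, hU.1, Matrix.one_mul]

theorem vonNeumannEntropy_cloningChannel_conj (hk : 1 ≤ k) {W ρ : Matrix (Fin d) (Fin d) ℂ}
    (hW : W * Wᴴ = 1) (hρ : ρ.PosSemidef) :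
    vonNeumannEntropy (cloningChannel d k (W * ρ * Wᴴ)) =
      vonNeumannEntropy (cloningChannel d k ρ) := by
  obtain ⟨Q, hQ, h⟩ := cloningChannel_covariant hk hW
  rw [h, vonNeumannEntropy_conj (cloningChannel_posSemidef hρ).isHermitian hQ]

theorem conditionalGain_conj_diagState (hk : 1 ≤ k)
    (hU : IsIsometricExtension (cloningChannel d k) U) (lam mu : ℝ)
    {W : Matrix (Fin d) (Fin d) ℂ} (hW : W * Wᴴ = 1) {v : Fin d → ℝ} (hv : ∀ i, 0 ≤ v i) :
    conditionalGain U lam mu (W * diagState v * Wᴴ) = conditionalGain U lam mu (diagState v) := by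
  obtain ⟨Q, hQ, h⟩ := cloningChannel_covariant hk hW
  have h1 : vonNeumannEntropy (traceFirst (U * (W * diagState v * Wᴴ) * Uᴴ)) =
      vonNeumannEntropy (traceFirst (U * diagState v * Uᴴ)) := by
    rw [diagState_eq_mul_conjTranspose hv]
    exact vonNeumannEntropy_traceFirst_conj hQ (fun ρ => by rw [hU.2, hU.2, h]) _
  rw [conditionalGain, conditionalGain, h1, hU.2, hU.2,
    vonNeumannEntropy_cloningChannel_conj hk hW (diagState_posSemidef hv)]

/-- All pure inputs have the same output entropy. -/
theorem vonNeumannEntropy_cloningChannel_pure [NeZero d] (hk : 1 ≤ k)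
    {X Y : Type*} [Fintype X] [Fintype Y] (ens : PureEnsemble X Y d) (x : X) (y : Y) :
    vonNeumannEntropy (cloningChannel d k (ens.density x y)) =
      vonNeumannEntropy (cloningChannel d k (diagState (Pi.single 0 1))) := by
  obtain ⟨W, v, hW', hW, hv, hρ⟩ :=
    exists_conj_diagState (ens.density_posSemidef x y) (ens.trace_density x y)
  -- A pure state is a projection, so its eigenvalues are 0 or 1, and trace one leaves a single 1. A
  -- swap moves it to index `0`.
  have hidem : ens.density x y * ens.density x y = ens.density x y := by
    have h1 := ens.trace_density x y
    rw [PureEnsemble.density, trace_vecMulVec] at h1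
    rw [PureEnsemble.density, vecMulVec_mul_vecMulVec, dotProduct_comm, h1, one_smul]
  have hsq : diagState v * diagState v = diagState v := by
    have h1 : diagState v = Wᴴ * ens.density x y * W := by
      rw [hρ]
      simp only [Matrix.mul_assoc, hW', Matrix.mul_one]
      rw [← Matrix.mul_assoc, hW', Matrix.one_mul]
    calc diagState v * diagState v
        = Wᴴ * (ens.density x y * (W * Wᴴ) * ens.density x y) * W := by
          rw [h1]; simp only [Matrix.mul_assoc]
      _ = diagState v := by rw [hW, Matrix.mul_one, hidem, h1]
  have h01 : ∀ i, v i = 0 ∨ v i = 1 := by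
    intro i
    have := congrFun (congrFun hsq i) i
    rw [diagState, diagonal_mul_diagonal, diagonal_apply_eq, diagonal_apply_eq,
      ← Complex.ofReal_mul, Complex.ofReal_inj] at this
    rcases eq_or_ne (v i) 0 with h | h
    · exact Or.inl h
    · exact Or.inr (mul_left_cancel₀ h (by rw [this, mul_one]))
  obtain ⟨i, hi⟩ : ∃ i, v i = 1 := by
    by_contra! hne
    have h0 : ∀ i, v i = 0 := fun i => (h01 i).resolve_right (hne i)
    have := hv.2
    simp [h0] at this
  have hvi : v = Pi.single 0 1 ∘ Equiv.swap 0 i := by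
    funext j
    by_cases hj : j = i
    · subst hj; simp [hi]
    · have hj0 : v j = 0 := by
        refine (h01 j).resolve_right fun h => ?_
        have := Finset.add_le_sum (fun l _ => hv.1 l) (Finset.mem_univ j) (Finset.mem_univ i) hj
        rw [hv.2, h, hi] at this
        norm_num at this
      have hne : Equiv.swap 0 i j ≠ 0 := by
        rw [Ne, Equiv.swap_apply_eq_iff, Equiv.swap_apply_left]
        exact hj
      simp [hj0, hne]
  obtain ⟨P, hP, hPv⟩ := exists_conj_diagState_comp (Equiv.swap (0 : Fin d) i)
  rw [hρ, vonNeumannEntropy_cloningChannel_conj hk hW (diagState_posSemidef hv.1), hvi, hPv,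
    vonNeumannEntropy_cloningChannel_conj hk hP]
  refine diagState_posSemidef fun j => ?_
  by_cases hj : j = 0
  · subst hj; simp
  · simp [hj]

theorem cloningIsometry_eq_zero {m : Occupation d k} {j : Occupation d (k - 1)} {i : Fin d}
    (h : m.1 ≠ Pi.single i 1 + j.1) : cloningIsometry d k (m, j) i = 0 := by
  rw [cloningIsometry, of_apply, if_neg h]

theorem conj_diagState_apply {B E : Type*} (V : Matrix (B × E) (Fin d) ℂ) (v : Fin d → ℝ)
    (s t : B × E) : (V * diagState v * Vᴴ) s t = ∑ i, V s i * v i * star (V t i) := by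
  rw [mul_apply]
  simp only [diagState, mul_diagonal, conjTranspose_apply]

theorem cloningChannel_diagState (v : Fin d → ℝ) : cloningChannel d k (diagState v) =
    diagonal fun m => ((∑ j, ∑ i, ‖cloningIsometry d k (m, j) i‖ ^ 2 * v i : ℝ) : ℂ) := by
  ext m m'
  simp only [cloningChannel, traceSecond, of_apply, conj_diagState_apply]
  by_cases h : m = m'
  · subst h
    rw [diagonal_apply_eq]
    push_cast
    refine Finset.sum_congr rfl fun j _ => Finset.sum_congr rfl fun i _ => ?_
    rw [mul_right_comm, Complex.star_def, Complex.mul_conj']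
  · rw [diagonal_apply_ne _ h]
    refine Finset.sum_eq_zero fun j _ => Finset.sum_eq_zero fun i _ => ?_
    by_cases h1 : m.1 = Pi.single i 1 + j.1
    · have h2 : m'.1 ≠ Pi.single i 1 + j.1 := fun h2 => h (Subtype.ext (h1.trans h2.symm))
      rw [cloningIsometry_eq_zero h2, star_zero, mul_zero]
    · rw [cloningIsometry_eq_zero h1, zero_mul, zero_mul]

/-- For given `m` and `i`, at most one `j` satisfies `m = e_i + j`, so no off-diagonal term
survives. -/
theorem traceFirst_cloningIsometry_diagState (v : Fin d → ℝ) :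
    traceFirst (cloningIsometry d k * diagState v * (cloningIsometry d k)ᴴ) =
    diagonal fun j => ((∑ m, ∑ i, ‖cloningIsometry d k (m, j) i‖ ^ 2 * v i : ℝ) : ℂ) := by
  ext j j'
  simp only [traceFirst, of_apply, conj_diagState_apply]
  by_cases h : j = j'
  · subst h
    rw [diagonal_apply_eq]
    push_cast
    refine Finset.sum_congr rfl fun m _ => Finset.sum_congr rfl fun i _ => ?_
    rw [mul_right_comm, Complex.star_def, Complex.mul_conj']
  · rw [diagonal_apply_ne _ h]
    refine Finset.sum_eq_zero fun m _ => Finset.sum_eq_zero fun i _ => ?_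
    by_cases h1 : m.1 = Pi.single i 1 + j.1
    · have h2 : m.1 ≠ Pi.single i 1 + j'.1 := fun h2 =>
        h (Subtype.ext (add_left_cancel (h1.symm.trans h2)))
      rw [cloningIsometry_eq_zero h2, star_zero, mul_zero]
    · rw [cloningIsometry_eq_zero h1, zero_mul, zero_mul]

theorem exists_isMaxOn_conditionalGain [NeZero d]
    (hU : IsIsometricExtension (cloningChannel d k) U) (lam mu : ℝ) :
    ∃ ν ∈ stdSimplex ℝ (Fin d),
      IsMaxOn (fun v => conditionalGain U lam mu (diagState v)) (stdSimplex ℝ (Fin d)) ν := by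
  refine (isCompact_stdSimplex ℝ (Fin d)).exists_isMaxOn ⟨_, single_mem_stdSimplex ℝ 0⟩ ?_
  -- On diagonal inputs both outputs of the cloner itself are diagonal with entries linear in `v`.
  -- An arbitrary `U` has the same entropies, which makes the gain continuous on the simplex.
  have hc : Continuous fun v : Fin d → ℝ =>
      lam * ((∑ m : Occupation d k, Real.negMulLog
          (∑ j, ∑ i, ‖cloningIsometry d k (m, j) i‖ ^ 2 * v i)) -
        ∑ j : Occupation d (k - 1), Real.negMulLog
          (∑ m, ∑ i, ‖cloningIsometry d k (m, j) i‖ ^ 2 * v i)) -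
      mu * ∑ j : Occupation d (k - 1), Real.negMulLog
          (∑ m, ∑ i, ‖cloningIsometry d k (m, j) i‖ ^ 2 * v i) := by
    have := Real.continuous_negMulLog
    fun_prop
  refine hc.continuousOn.congr fun v hv => ?_
  have h1 : vonNeumannEntropy (traceFirst (U * diagState v * Uᴴ)) =
      ∑ j : Occupation d (k - 1), Real.negMulLog
          (∑ m, ∑ i, ‖cloningIsometry d k (m, j) i‖ ^ 2 * v i) := by
    rw [← vonNeumannEntropy_diagonal, ← traceFirst_cloningIsometry_diagState,
      diagState_eq_mul_conjTranspose hv.1]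
    exact vonNeumannEntropy_traceFirst_eq hU.2 _
  rw [conditionalGain, h1, hU.2, cloningChannel_diagState, vonNeumannEntropy_diagonal]

theorem privateDynamicObjective_cloning [NeZero d] (hk : 1 ≤ k)
    (hU : IsIsometricExtension (cloningChannel d k) U) (lam mu : ℝ)
    {X Y : Type*} [Fintype X] [Fintype Y] [DecidableEq X] [DecidableEq Y]
    (ens : PureEnsemble X Y d)
    {σ : X → Matrix (Fin d) (Fin d) ℂ} (hσ : ∀ x, (σ x).PosSemidef) (ht : ∀ x, (σ x).trace = 1)
    (hens : ∀ x, ∑ y, (ens.prob x y : ℂ) • ens.density x y = ((∑ y, ens.prob x y : ℝ) : ℂ) • σ x) :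
    privateDynamicObjective U lam mu ens =
      (1 + mu) * vonNeumannEntropy
        (cloningChannel d k (∑ x, ∑ y, (ens.prob x y : ℂ) • ens.density x y))
      - vonNeumannEntropy (cloningChannel d k (diagState (Pi.single 0 1)))
      + ∑ x, (∑ y, ens.prob x y) * conditionalGain U lam mu (σ x) := by
  rw [privateDynamicObjective_eq ens hU.1 lam mu hσ ht hens, hU.2]
  congr 2
  simp only [hU.2, vonNeumannEntropy_cloningChannel_pure hk, ← Finset.sum_mul, ens.prob_sum,
    one_mul]

theorem PureEnsemble.posSemidef_smul_density {X Y : Type*} [Fintype X] [Fintype Y]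
    (ens : PureEnsemble X Y d) (x : X) (y : Y) :
    ((ens.prob x y : ℂ) • ens.density x y).PosSemidef :=
  (ens.density_posSemidef x y).smul (Complex.zero_le_real.2 (ens.prob_nonneg x y))

theorem PureEnsemble.exists_conditional_state [NeZero d] {X Y : Type*} [Fintype X] [Fintype Y]
    (ens : PureEnsemble X Y d) (x : X) : ∃ σ : Matrix (Fin d) (Fin d) ℂ,
      σ.PosSemidef ∧ σ.trace = 1 ∧ ∑ y, (ens.prob x y : ℂ) • ens.density x y =
        ((∑ y, ens.prob x y : ℝ) : ℂ) • σ := by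
  -- If `x` has probability zero, any state serves.
  by_cases hp : ∑ y, ens.prob x y = 0
  · have h0 : ∀ y, ens.prob x y = 0 := fun y =>
      (Finset.sum_eq_zero_iff_of_nonneg fun y _ => ens.prob_nonneg x y).1 hp y (Finset.mem_univ y)
    have hs := single_mem_stdSimplex ℝ (0 : Fin d)
    refine ⟨diagState (Pi.single 0 1), diagState_posSemidef hs.1, trace_diagState hs, ?_⟩
    simp [h0]
  · have hp' : ((∑ y, ens.prob x y : ℝ) : ℂ) ≠ 0 := Complex.ofReal_ne_zero.2 hp
    refine ⟨((∑ y, ens.prob x y : ℝ) : ℂ)⁻¹ • ∑ y, (ens.prob x y : ℂ) • ens.density x y,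
      ?_, ?_, ?_⟩
    · rw [← Complex.ofReal_inv]
      exact (posSemidef_sum _ fun y _ => ens.posSemidef_smul_density x y).smul
        (Complex.zero_le_real.2 (inv_nonneg.2 (Finset.sum_nonneg fun y _ => ens.prob_nonneg x y)))
    · rw [trace_smul, trace_sum]
      simp only [trace_smul, ens.trace_density, smul_eq_mul, mul_one]
      rw [← Complex.ofReal_sum, inv_mul_cancel₀ hp']
    · rw [smul_smul, mul_inv_cancel₀ hp', one_smul]

theorem nonempty_occupation [NeZero d] : Nonempty (Occupation d k) :=
  ⟨⟨Pi.single 0 k, Finset.mem_piAntidiag.2 ⟨by simp, by simp⟩⟩⟩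

/-- The dimension bound on `H(B)` is multiplied by `1 + mu ≥ 0`. Each conditional state is
diagonalized, after which the maximality of `ν` applies. -/
theorem privateDynamicObjective_le [NeZero d] (hk : 1 ≤ k)
    (hU : IsIsometricExtension (cloningChannel d k) U) {lam mu : ℝ} (hmu : 0 ≤ mu)
    {ν : Fin d → ℝ} (hmax : IsMaxOn (fun v => conditionalGain U lam mu (diagState v))
      (stdSimplex ℝ (Fin d)) ν)
    {X Y : Type*} [Fintype X] [Fintype Y] [DecidableEq X] [DecidableEq Y]
    (ens : PureEnsemble X Y d) :
    privateDynamicObjective U lam mu ens ≤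
      (1 + mu) * Real.log (Fintype.card (Occupation d k))
      - vonNeumannEntropy (cloningChannel d k (diagState (Pi.single 0 1)))
      + conditionalGain U lam mu (diagState ν) := by
  choose σ hσ ht hens using ens.exists_conditional_state
  rw [privateDynamicObjective_cloning hk hU lam mu ens hσ ht hens]
  have : Nonempty (Occupation d k) := nonempty_occupation
  refine add_le_add (sub_le_sub_right (mul_le_mul_of_nonneg_left ?_ (by linarith)) _) ?_
  · refine vonNeumannEntropy_le_log_card (cloningChannel_posSemidef ?_) ?_
    · exact posSemidef_sum _ fun x _ => posSemidef_sum _ fun y _ => ens.posSemidef_smul_density x y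
    · rw [hU.trace_cloningChannel]
      simp only [trace_sum, trace_smul, ens.trace_density, smul_eq_mul, mul_one]
      exact_mod_cast ens.prob_sum
  · calc ∑ x, (∑ y, ens.prob x y) * conditionalGain U lam mu (σ x)
        ≤ ∑ x, (∑ y, ens.prob x y) * conditionalGain U lam mu (diagState ν) := by
          refine Finset.sum_le_sum fun x _ => mul_le_mul_of_nonneg_left ?_
            (Finset.sum_nonneg fun y _ => ens.prob_nonneg x y)
          obtain ⟨W, v, -, hW, hv, hρ⟩ := exists_conj_diagState (hσ x) (ht x)
          rw [hρ, conditionalGain_conj_diagState hk hU lam mu hW hv.1]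
          exact hmax hv
      _ = conditionalGain U lam mu (diagState ν) := by
          rw [← Finset.sum_mul, ens.prob_sum, one_mul]

theorem privateDynamicObjective_cyclicEnsemble [NeZero d] (hk : 1 ≤ k)
    (hU : IsIsometricExtension (cloningChannel d k) U) (lam mu : ℝ)
    (ν : Fin d → ℝ) (hν : ν ∈ stdSimplex ℝ (Fin d)) :
    privateDynamicObjective U lam mu (cyclicEnsemble d ν hν) =
      (1 + mu) * Real.log (Fintype.card (Occupation d k))
      - vonNeumannEntropy (cloningChannel d k (diagState (Pi.single 0 1)))
      + conditionalGain U lam mu (diagState ν) := by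
  have hd : (d : ℝ) ≠ 0 := Nat.cast_ne_zero.2 (NeZero.ne d)
  have hshift : ∀ x, ν ∘ Equiv.subRight x ∈ stdSimplex ℝ (Fin d) := fun x =>
    ⟨fun i => hν.1 _, ((Equiv.subRight x).sum_comp ν).trans hν.2⟩
  have hprob : ∀ x, ∑ y, (cyclicEnsemble d ν hν).prob x y = 1 / (d : ℝ) := fun x => by
    have : ∑ y, ν (y - x) = 1 := (hshift x).2
    simp only [cyclicEnsemble]
    rw [← Finset.mul_sum, this, mul_one]
  have hcond : ∀ x, ∑ y, ((cyclicEnsemble d ν hν).prob x y : ℂ) •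
      (cyclicEnsemble d ν hν).density x y =
      ((1 / (d : ℝ) : ℝ) : ℂ) • diagState (ν ∘ Equiv.subRight x) := by
    intro x
    ext i j
    simp only [Matrix.sum_apply, Matrix.smul_apply, cyclicEnsemble, PureEnsemble.density,
      vecMulVec_apply, Pi.star_apply, diagState, diagonal_apply, smul_eq_mul, Function.comp_apply]
    rw [Finset.sum_eq_single i]
    · by_cases h : i = j
      · subst h; simp
      · simp [h, Ne.symm h]
    · intro y _ hy
      simp [hy.symm]
    · simp
  rw [privateDynamicObjective_cloning hk hU lam mu _
    (σ := fun x => diagState (ν ∘ Equiv.subRight x)) (fun x => diagState_posSemidef (hshift x).1)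
    (fun x => trace_diagState (hshift x)) (fun x => by rw [hcond, hprob])]
  have : Nonempty (Occupation d k) := nonempty_occupation
  congr 1
  · congr 2
    obtain ⟨c, hc⟩ := exists_cloningChannel_one (d := d) hk
    -- Averaged over `x`, each diagonal position meets every `ν_i` exactly once. The input is thus
    -- maximally mixed, and so is its output, since the channel maps `1` to a multiple of `1`.
    have havg : ∑ x, ∑ y, ((cyclicEnsemble d ν hν).prob x y : ℂ) •
        (cyclicEnsemble d ν hν).density x y = ((1 / (d : ℝ) : ℝ) : ℂ) • 1 := by
      simp only [hcond, ← Finset.smul_sum]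
      congr 1
      ext i j
      simp only [Matrix.sum_apply, diagState, diagonal_apply, one_apply, Function.comp_apply]
      by_cases h : i = j
      · simp only [h, if_true]
        have : ∑ x, ν (j - x) = 1 := ((Equiv.subLeft j).sum_comp ν).trans hν.2
        exact_mod_cast this
      · simp [h]
    have hsc : cloningChannel d k (((1 / (d : ℝ) : ℝ) : ℂ) • (1 : Matrix (Fin d) (Fin d) ℂ)) =
        (((1 / (d : ℝ) : ℝ) : ℂ) * c) • 1 := by
      rw [← smul_smul, ← hc, cloningChannel, cloningChannel, Matrix.mul_smul, Matrix.smul_mul,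
        traceSecond_smul]
    rw [havg]
    refine vonNeumannEntropy_uniform hsc ?_
    rw [hU.trace_cloningChannel, trace_smul, trace_one, Fintype.card_fin, smul_eq_mul]
    have hd' : (d : ℂ) ≠ 0 := Nat.cast_ne_zero.2 (NeZero.ne d)
    push_cast
    field_simp
  · have hgain : ∀ x, conditionalGain U lam mu (diagState (ν ∘ Equiv.subRight x)) =
        conditionalGain U lam mu (diagState ν) := fun x => by
      obtain ⟨P, hP, hPv⟩ := exists_conj_diagState_comp (Equiv.subRight x)
      rw [hPv, conditionalGain_conj_diagState hk hU lam mu hP hν.1]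
    simp only [hgain, hprob, Finset.sum_const, Finset.card_univ, Fintype.card_fin, nsmul_eq_mul]
    field_simp

end Extension

end Maximum

theorem theorem6 (d k : ℕ) [NeZero d] (hk : 1 ≤ k) (lam mu : ℝ) (hlam : 0 ≤ lam) (hmu : 0 ≤ mu)
    {E : Type*} [Fintype E] [DecidableEq E] (U : Matrix (Occupation d k × E) (Fin d) ℂ)
    (hU : IsIsometricExtension (cloningChannel d k) U) :
    ∃ (ν : Fin d → ℝ) (hν : ν ∈ stdSimplex ℝ (Fin d)),
      IsGreatest (privateDynamicValues U lam mu)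
        (privateDynamicObjective U lam mu (cyclicEnsemble d ν hν)) := by
  obtain ⟨ν, hν, hmax⟩ := exists_isMaxOn_conditionalGain hU lam mu
  refine ⟨ν, hν, ⟨Fin d, Fin d, inferInstance, inferInstance, inferInstance, inferInstance,
    cyclicEnsemble d ν hν, rfl⟩, ?_⟩
  rintro _ ⟨X, Y, _, _, _, _, ens, rfl⟩
  rw [privateDynamicObjective_cyclicEnsemble hk hU lam mu ν hν]
  exact privateDynamicObjective_le hk hU hmu hmax ens
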